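/- **Setting.** All results are local, so let $M\subseteq\mathbb R^3$ be open with contact form $dy-z\,dx$ and let $P\subseteq\mathbb R^5$ be open; everything is smooth. Let $\rho:P\to M$ be a surjective submersion with connected (two-dimensional) fibres and $L$ a line field on $P$ transverse to the fibres. Let $\mathcal I$ be the Pfaffian system annihilating $L$ and the fibres of $\rho$, and let $\mathcal J$ be the intersection of the retracting space (Cartan system) of $\mathcal I$ with $L^\perp$. Then $(P,L,\rho)$ is a *contact path geometry* if $\rho_*L$ is tangent to the contact planes, the first derived system $\mathcal I'$ has rank one, and $\mathcal J'=\mathcal I$. Its *paths* are the regular integral curves of $L$. A coframe $(\sigma,\theta_0,\theta_1,\theta_2,\theta_3)$ on $P$ is *adapted* if $\theta_0(v)=0$ exactly when $\rho_*v$ is a contact direction, $\mathcal I=\{\theta_0,\theta_1\}$, $\mathcal J=\{\theta_0,\theta_1,\theta_2\}$, and $L^\perp=\{\theta_0,\theta_1,\theta_2,\theta_3\}$. Suppose it satisfies Fels' structure equations $$\begin{aligned} d\sigma&=\alpha\wedge\sigma+\theta_0\wedge(T_1\theta_1+T_2\theta_2+T_3\theta_3)+\theta_1\wedge(T_4\theta_2+T_5\theta_3),\\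 d\theta_0&=\beta\wedge\theta_0+\sigma\wedge\theta_1,\\ d\theta_1&=(\beta-\alpha)\wedge\theta_1+\gamma\wedge\theta_0+\sigma\wedge\theta_2,\\ d\theta_2&=(\beta-2\alpha)\wedge\theta_2+\tfrac43\gamma\wedge\theta_1+\sigma\wedge\theta_3,\\ d\theta_3&=(\beta-3\alpha)\wedge\theta_3+\gamma\wedge\theta_2+\sigma\wedge(I_0\theta_0+I_1\theta_1)+T_6\theta_0\wedge\theta_1+T_7\theta_0\wedge\theta_2+T_8\theta_1\wedge\theta_2 \end{aligned}$$ for some 1-forms $\alpha,\beta,\gamma$ and functions $I_0,I_1,T_1,\dots,T_8$. The geometry is *variational* if $I_1=T_5=T_8=0$ and *definite* if $T_4<0$. The coframe is *canonical* if $T_2=0$, $T_4=-1$ and $3\alpha-2\beta=0$. Let $W_0,W_1,W_2$ be the coefficients of $\theta_0,\theta_1,\theta_2$ in the expansion of $\beta-2\alpha$ in the coframe, and define $H,G_0,\dots,G_3$ by $\gamma=H\sigma-3(G_0\theta_0+G_1\theta_1+G_2\theta_2+G_3\theta_3)$. A sub-Riemannian metric on $M$ is a smooth positive definite quadratic form $E\,dx^2+F\,dx\,dz+G\,dz^2$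 on the contact planes. A *geodesic* is a smooth regular contact curve that is extremal for arclength under all compactly supported smooth variations through contact curves. **Theorem.** Let $P$ carry a variational and definite contact path geometry, with a fixed canonical coframe $(\sigma,\theta_0,\theta_1,\theta_2,\theta_3)$ on $P$, and suppose $W_2\equiv0$ on $P$. Then there is a sub-Riemannian metric $g$ on $M$ defined by $\sigma^2+\theta_1^2$, that is, with $g(\rho_*v,\rho_*v)=\sigma(v)^2+\theta_1(v)^2$ for every $v\in TP$ that projects to a contact direction; and the paths in $P$ project to geodesics of $g$ in $M$ if and only if $G_1=2W_0$ identically on $P$. -/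

import Mathlib

open Set Filter Topology
open scoped ContDiff

noncomputable section

namespace ContactPath

/-! ### Differential 1-forms on open subsets of `ℝⁿ` -/

/-- The coordinate space `ℝⁿ`. -/
abbrev Vec (n : ℕ) : Type := Fin n → ℝ

/-- Covectors on `ℝⁿ`. -/
abbrev Covec (n : ℕ) : Type := Vec n →L[ℝ] ℝ

/-- Differential 1-forms on `ℝⁿ` (only their values on an open set matter). -/
abbrev OneForm (n : ℕ) : Type := Vec n → Covec n

/-- The wedge product of two covectors, `(φ ⋏ ψ)(v, w) = φ(v) ψ(w) - φ(w) ψ(v)`. -/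
def wedge {n : ℕ} (φ ψ : Covec n) : Vec n → Vec n → ℝ :=
  fun v w => φ v * ψ w - φ w * ψ v

infixl:75 " ⋏ " => wedge

/-- The exterior derivative of a 1-form at a point, as a function of two tangent vectors. -/
def extD {n : ℕ} (ϑ : OneForm n) (p : Vec n) : Vec n → Vec n → ℝ :=
  fun v w => extDeriv
    (fun q => ContinuousAlternatingMap.ofSubsingleton ℝ (Vec n) ℝ (0 : Fin 1) (ϑ q)) p ![v, w]

/-- `dϑ(v, w) = (D_v ϑ)(w) - (D_w ϑ)(v)`. -/
theorem extD_apply {n : ℕ} {ϑ : OneForm n} {p : Vec n} (h : DifferentiableAt ℝ ϑ p)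
    (v w : Vec n) : extD ϑ p v w = fderiv ℝ ϑ p v w - fderiv ℝ ϑ p w v := by
  have hL := (ContinuousAlternatingMap.ofSubsingletonLIE (𝕜 := ℝ) (E := Vec n) (F := ℝ)
    (0 : Fin 1)).toContinuousLinearEquiv.hasFDerivAt.comp p h.hasFDerivAt
  have h' : HasFDerivAt (fun q => ContinuousAlternatingMap.ofSubsingleton ℝ (Vec n) ℝ
      (0 : Fin 1) (ϑ q)) _ p := hL
  rw [extD, extDeriv_apply h'.differentiableAt, Fin.sum_univ_two]
  have e : ∀ u : Vec n, fderiv ℝ (fun q => ϑ q u) p = (fderiv ℝ ϑ p).flip u := by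
    intro u
    ext x
    simp [fderiv_clm_apply h (differentiableAt_const u)]
  simp [e, Fin.removeNth]
  ring

/-! ### Pfaffian systems -/

/-- The covectors that vanish on a subspace of the tangent space. -/
def ann {n : ℕ} (S : Submodule ℝ (Vec n)) : Submodule ℝ (Covec n) where
  carrier := {φ | ∀ v ∈ S, φ v = 0}
  add_mem' := fun {φ ψ} hφ hψ v hv => by simp [hφ v hv, hψ v hv]
  zero_mem' := fun v _ => by simp
  smul_mem' := fun c φ hφ v hv => by simp [hφ v hv]

/-- The tangent vectors on which all covectors of a subspace vanish. -/
def coann {n : ℕ} (A : Submodule ℝ (Covec n)) : Submodule ℝ (Vec n) where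
  carrier := {v | ∀ φ ∈ A, φ v = 0}
  add_mem' := fun {v w} hv hw φ hφ => by simp [hv φ hφ, hw φ hφ]
  zero_mem' := fun φ _ => by simp
  smul_mem' := fun c v hv φ hφ => by simp [hv φ hφ]

/-- A Pfaffian system: a field of subspaces of the cotangent spaces. -/
abbrev PfaffianSystem (n : ℕ) : Type := Vec n → Submodule ℝ (Covec n)

/-- `ϑ` is a smooth section of `A` on some neighbourhood of `p`. -/
def IsSectionNear {n : ℕ} (A : PfaffianSystem n) (p : Vec n) (ϑ : OneForm n) : Prop :=
  ∀ᶠ q in 𝓝 p, ContDiffAt ℝ ∞ ϑ q ∧ ϑ q ∈ A q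

/-- The first derived system `A'` at `p`: the values at `p` of the local sections `ϑ` of `A`
with `dϑ ≡ 0` modulo `A` at `p`. -/
def derivedSystem {n : ℕ} (A : PfaffianSystem n) : PfaffianSystem n := fun p =>
  Submodule.span ℝ {φ | ∃ ϑ : OneForm n, IsSectionNear A p ϑ ∧ ϑ p = φ ∧
    ∀ v ∈ coann (A p), ∀ w ∈ coann (A p), extD ϑ p v w = 0}

/-- The Cauchy characteristic space of `A` at `p`: the vectors `v` annihilated by `A` whose
contraction with `dϑ` lies in `A` for every local section `ϑ` of `A`. -/
def cauchyChar {n : ℕ} (A : PfaffianSystem n) (p : Vec n) : Submodule ℝ (Vec n) :=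
  Submodule.span ℝ {v | v ∈ coann (A p) ∧
    ∀ ϑ : OneForm n, IsSectionNear A p ϑ → ∀ w ∈ coann (A p), extD ϑ p v w = 0}

/-- The retracting space (Cartan system) of `A`: the annihilator of its Cauchy
characteristics. -/
def retractingSpace {n : ℕ} (A : PfaffianSystem n) : PfaffianSystem n := fun p =>
  ann (cauchyChar A p)

/-! ### The contact structure and sub-Riemannian metrics on an open subset of `ℝ³` -/

/-- The contact form `dy - z dx` on `ℝ³` with coordinates `(x, y, z)`. -/
def contactForm : OneForm 3 := fun q =>
  ContinuousLinearMap.proj (R := ℝ) (φ := fun _ : Fin 3 => ℝ) 1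
    - q 2 • ContinuousLinearMap.proj (R := ℝ) (φ := fun _ : Fin 3 => ℝ) 0

/-- A sub-Riemannian metric `E dx² + F dx dz + G dz²` on the contact planes over `M`
(`dx` and `dz` restrict to a basis of the dual of each contact plane). -/
structure SubRiemannianMetric (M : Set (Vec 3)) where
  /-- coefficient of `dx²` -/
  E : Vec 3 → ℝ
  /-- coefficient of `dx dz` -/
  F : Vec 3 → ℝ
  /-- coefficient of `dz²` -/
  G : Vec 3 → ℝ
  smooth_E : ContDiffOn ℝ ∞ E M
  smooth_F : ContDiffOn ℝ ∞ F M
  smooth_G : ContDiffOn ℝ ∞ G M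
  pos : ∀ q ∈ M, ∀ a b : ℝ, (a, b) ≠ (0, 0) → 0 < E q * a ^ 2 + F q * a * b + G q * b ^ 2

/-- The squared length of a contact vector `v` at `q`. -/
def SubRiemannianMetric.sq {M : Set (Vec 3)} (g : SubRiemannianMetric M) (q v : Vec 3) : ℝ :=
  g.E q * v 0 ^ 2 + g.F q * v 0 * v 2 + g.G q * v 2 ^ 2

/-- The arclength on `[a, b]` of a contact curve. -/
def SubRiemannianMetric.length {M : Set (Vec 3)} (g : SubRiemannianMetric M)
    (c : ℝ → Vec 3) (a b : ℝ) : ℝ :=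
  ∫ t in a..b, √(g.sq (c t) (deriv c t))

/-- `Γ (s, t)`, `|s| < ε`, `t ∈ J`, is a smooth variation of `c` through contact curves in `M`
that is supported in `[a, b]`. -/
structure IsContactVariation (M : Set (Vec 3)) (c : ℝ → Vec 3) (J : Set ℝ) (a b ε : ℝ)
    (Γ : ℝ × ℝ → Vec 3) : Prop where
  smooth : ContDiffOn ℝ ∞ Γ (Ioo (-ε) ε ×ˢ J)
  zero : ∀ t ∈ J, Γ (0, t) = c t
  support : ∀ s ∈ Ioo (-ε) ε, ∀ t ∈ J \ Icc a b, Γ (s, t) = c t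
  mem : ∀ s ∈ Ioo (-ε) ε, ∀ t ∈ J, Γ (s, t) ∈ M
  contact : ∀ s ∈ Ioo (-ε) ε, ∀ t ∈ J,
    contactForm (Γ (s, t)) (deriv (fun τ => Γ (s, τ)) t) = 0

/-- A geodesic of the sub-Riemannian metric `g`, parametrized by the open interval `J`: a smooth
regular contact curve in `M` that is extremal for arclength under all compactly supported
variations through contact curves. -/
structure IsGeodesic {M : Set (Vec 3)} (g : SubRiemannianMetric M) (c : ℝ → Vec 3)
    (J : Set ℝ) : Prop where
  smooth : ContDiffOn ℝ ∞ c J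
  mem : ∀ t ∈ J, c t ∈ M
  regular : ∀ t ∈ J, deriv c t ≠ 0
  contact : ∀ t ∈ J, contactForm (c t) (deriv c t) = 0
  extremal : ∀ a b ε : ℝ, a < b → Icc a b ⊆ J → 0 < ε → ∀ Γ : ℝ × ℝ → Vec 3,
    IsContactVariation M c J a b ε Γ →
      HasDerivAt (fun s => g.length (fun t => Γ (s, t)) a b) 0 0

/-! ### Contact path geometries -/

/-- The system `I` of a line field `L` and a submersion `ρ`: the covectors that vanish on `L` and
on the fibres of `ρ`. -/
def systemI (ρ : Vec 5 → Vec 3) (L : Vec 5 → Submodule ℝ (Vec 5)) : PfaffianSystem 5 :=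
  fun p => ann (L p ⊔ LinearMap.ker (fderiv ℝ ρ p).toLinearMap)

/-- The system `J`: the intersection of the retracting space of `I` with the annihilator
of `L`. -/
def systemJ (ρ : Vec 5 → Vec 3) (L : Vec 5 → Submodule ℝ (Vec 5)) : PfaffianSystem 5 :=
  fun p => retractingSpace (systemI ρ L) p ⊓ ann (L p)

/-- `(P, L, ρ)` is a contact path geometry on the open set `M ⊆ ℝ³` with contact form
`dy - z dx`. -/
structure IsContactPathGeometry (P : Set (Vec 5)) (M : Set (Vec 3)) (ρ : Vec 5 → Vec 3)
    (L : Vec 5 → Submodule ℝ (Vec 5)) : Prop where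
  isOpen_P : IsOpen P
  isOpen_M : IsOpen M
  smooth : ContDiffOn ℝ ∞ ρ P
  mapsTo : MapsTo ρ P M
  submersion : ∀ p ∈ P, Function.Surjective (fderiv ℝ ρ p)
  /-- the fibres are non-empty and connected -/
  fibre : ∀ x ∈ M, IsConnected (P ∩ ρ ⁻¹' {x})
  /-- `L` is a smooth line field -/
  lineField : ∀ p ∈ P, ∃ X : Vec 5 → Vec 5, ∀ᶠ q in 𝓝 p,
    ContDiffAt ℝ ∞ X q ∧ X q ≠ 0 ∧ L q = Submodule.span ℝ {X q}
  transverse : ∀ p ∈ P, Disjoint (L p) (LinearMap.ker (fderiv ℝ ρ p).toLinearMap)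
  contact : ∀ p ∈ P, ∀ v ∈ L p, contactForm (ρ p) (fderiv ℝ ρ p v) = 0
  derived_I : ∀ p ∈ P, Module.finrank ℝ (derivedSystem (systemI ρ L) p) = 1
  derived_J : ∀ p ∈ P, derivedSystem (systemJ ρ L) p = systemI ρ L p

/-- A path, parametrized by the open interval `J`: a smooth regular integral curve of `L`. -/
structure IsPath (P : Set (Vec 5)) (L : Vec 5 → Submodule ℝ (Vec 5)) (γ : ℝ → Vec 5)
    (J : Set ℝ) : Prop where
  smooth : ContDiffOn ℝ ∞ γ J
  mem : ∀ t ∈ J, γ t ∈ P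
  regular : ∀ t ∈ J, deriv γ t ≠ 0
  tangent : ∀ t ∈ J, deriv γ t ∈ L (γ t)

/-- All paths project to geodesics of `g`. -/
def PathsAreGeodesics {M : Set (Vec 3)} (P : Set (Vec 5)) (ρ : Vec 5 → Vec 3)
    (L : Vec 5 → Submodule ℝ (Vec 5)) (g : SubRiemannianMetric M) : Prop :=
  ∀ (γ : ℝ → Vec 5) (J : Set ℝ), IsOpen J → J.OrdConnected → IsPath P L γ J →
    IsGeodesic g (ρ ∘ γ) J

/-! ### Adapted coframes, connection and torsion -/

/-- Five 1-forms `(σ, θ₀, θ₁, θ₂, θ₃)`. -/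
structure Coframe where
  σ : OneForm 5
  θ₀ : OneForm 5
  θ₁ : OneForm 5
  θ₂ : OneForm 5
  θ₃ : OneForm 5

/-- `(σ, θ₀, θ₁, θ₂, θ₃)` is a smooth coframe on `P` adapted to the contact path geometry. -/
structure Coframe.IsAdapted (η : Coframe) (P : Set (Vec 5)) (ρ : Vec 5 → Vec 3)
    (L : Vec 5 → Submodule ℝ (Vec 5)) : Prop where
  smooth : ContDiffOn ℝ ∞ η.σ P ∧ ContDiffOn ℝ ∞ η.θ₀ P ∧ ContDiffOn ℝ ∞ η.θ₁ P ∧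
    ContDiffOn ℝ ∞ η.θ₂ P ∧ ContDiffOn ℝ ∞ η.θ₃ P
  linearIndependent : ∀ p ∈ P,
    LinearIndependent ℝ ![η.σ p, η.θ₀ p, η.θ₁ p, η.θ₂ p, η.θ₃ p]
  contact : ∀ p ∈ P, ∀ v : Vec 5, contactForm (ρ p) (fderiv ℝ ρ p v) = 0 ↔ η.θ₀ p v = 0
  span_I : ∀ p ∈ P, systemI ρ L p = Submodule.span ℝ {η.θ₀ p, η.θ₁ p}
  span_J : ∀ p ∈ P, systemJ ρ L p = Submodule.span ℝ {η.θ₀ p, η.θ₁ p, η.θ₂ p}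
  span_L : ∀ p ∈ P, ann (L p) = Submodule.span ℝ {η.θ₀ p, η.θ₁ p, η.θ₂ p, η.θ₃ p}

/-- The pullbacks to `P` of the connection forms `α, β, γ` and torsion components of the canonical
connection of a contact path geometry. -/
structure ConnectionData where
  α : OneForm 5
  β : OneForm 5
  γ : OneForm 5
  I₀ : Vec 5 → ℝ
  I₁ : Vec 5 → ℝ
  T₁ : Vec 5 → ℝ
  T₂ : Vec 5 → ℝ
  T₃ : Vec 5 → ℝ
  T₄ : Vec 5 → ℝ
  T₅ : Vec 5 → ℝ
  T₆ : Vec 5 → ℝ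
  T₇ : Vec 5 → ℝ
  T₈ : Vec 5 → ℝ

/-- Fels' structure equations: `η` is a section over `P` of the reduced bundle, and `C` holds its
connection forms and torsion components. -/
structure Coframe.StructureEquations (η : Coframe) (C : ConnectionData) (P : Set (Vec 5)) :
    Prop where
  smooth_forms : ContDiffOn ℝ ∞ C.α P ∧ ContDiffOn ℝ ∞ C.β P ∧ ContDiffOn ℝ ∞ C.γ P
  smooth_torsion : ContDiffOn ℝ ∞ C.I₀ P ∧ ContDiffOn ℝ ∞ C.I₁ P ∧ ContDiffOn ℝ ∞ C.T₁ P ∧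
    ContDiffOn ℝ ∞ C.T₂ P ∧ ContDiffOn ℝ ∞ C.T₃ P ∧ ContDiffOn ℝ ∞ C.T₄ P ∧
    ContDiffOn ℝ ∞ C.T₅ P ∧ ContDiffOn ℝ ∞ C.T₆ P ∧ ContDiffOn ℝ ∞ C.T₇ P ∧
    ContDiffOn ℝ ∞ C.T₈ P
  d_σ : ∀ p ∈ P, extD η.σ p = C.α p ⋏ η.σ p
    + η.θ₀ p ⋏ (C.T₁ p • η.θ₁ p + C.T₂ p • η.θ₂ p + C.T₃ p • η.θ₃ p)
    + η.θ₁ p ⋏ (C.T₄ p • η.θ₂ p + C.T₅ p • η.θ₃ p)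
  d_θ₀ : ∀ p ∈ P, extD η.θ₀ p = C.β p ⋏ η.θ₀ p + η.σ p ⋏ η.θ₁ p
  d_θ₁ : ∀ p ∈ P, extD η.θ₁ p =
    (C.β p - C.α p) ⋏ η.θ₁ p + C.γ p ⋏ η.θ₀ p + η.σ p ⋏ η.θ₂ p
  d_θ₂ : ∀ p ∈ P, extD η.θ₂ p =
    (C.β p - (2 : ℝ) • C.α p) ⋏ η.θ₂ p + (4 / 3 : ℝ) • (C.γ p ⋏ η.θ₁ p) + η.σ p ⋏ η.θ₃ p
  d_θ₃ : ∀ p ∈ P, extD η.θ₃ p =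
    (C.β p - (3 : ℝ) • C.α p) ⋏ η.θ₃ p + C.γ p ⋏ η.θ₂ p
    + η.σ p ⋏ (C.I₀ p • η.θ₀ p + C.I₁ p • η.θ₁ p)
    + C.T₆ p • (η.θ₀ p ⋏ η.θ₁ p) + C.T₇ p • (η.θ₀ p ⋏ η.θ₂ p) + C.T₈ p • (η.θ₁ p ⋏ η.θ₂ p)

/-- The path geometry is variational. -/
def ConnectionData.IsVariational (C : ConnectionData) (P : Set (Vec 5)) : Prop :=
  ∀ p ∈ P, C.I₁ p = 0 ∧ C.T₅ p = 0 ∧ C.T₈ p = 0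

/-- The path geometry is definite. -/
def ConnectionData.IsDefinite (C : ConnectionData) (P : Set (Vec 5)) : Prop :=
  ∀ p ∈ P, C.T₄ p < 0

/-- The coframe is canonical: `T₂ = 0`, `T₄ = -1` and `3α - 2β = 0` along it. -/
def ConnectionData.IsCanonical (C : ConnectionData) (P : Set (Vec 5)) : Prop :=
  ∀ p ∈ P, C.T₂ p = 0 ∧ C.T₄ p = -1 ∧ (3 : ℝ) • C.α p - (2 : ℝ) • C.β p = 0

/-- `W₀, W₁, W₂` are the coefficients of `θ₀, θ₁, θ₂` in the expansion of `β - 2α` in the coframe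
`η` (the coefficients `a`, `b` of `σ` and `θ₃` are left unnamed; along a canonical coframe of a
variational geometry they turn out to be zero). -/
def Coframe.IsExpansionW (η : Coframe) (C : ConnectionData) (P : Set (Vec 5))
    (W₀ W₁ W₂ : Vec 5 → ℝ) : Prop :=
  ∀ p ∈ P, ∃ a b : ℝ, C.β p - (2 : ℝ) • C.α p =
    W₀ p • η.θ₀ p + W₁ p • η.θ₁ p + W₂ p • η.θ₂ p + a • η.σ p + b • η.θ₃ p

/-- `H, G₀, G₁, G₂, G₃` are the coefficients in the expansion
`γ = H σ - 3 (G₀ θ₀ + G₁ θ₁ + G₂ θ₂ + G₃ θ₃)`. -/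
def Coframe.IsExpansionG (η : Coframe) (C : ConnectionData) (P : Set (Vec 5))
    (H G₀ G₁ G₂ G₃ : Vec 5 → ℝ) : Prop :=
  ∀ p ∈ P, C.γ p = H p • η.σ p
    - (3 : ℝ) • (G₀ p • η.θ₀ p + G₁ p • η.θ₁ p + G₂ p • η.θ₂ p + G₃ p • η.θ₃ p)

/-- The metric `g` on the contact planes of `M` is the one defined by `σ² + θ₁²` on `P`: its
pullback by `ρ` agrees with `σ² + θ₁²` on the vectors that project to contact directions. -/
def SubRiemannianMetric.IsDefinedBy {M : Set (Vec 3)} (g : SubRiemannianMetric M)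
    (η : Coframe) (P : Set (Vec 5)) (ρ : Vec 5 → Vec 3) : Prop :=
  ∀ p ∈ P, ∀ v : Vec 5, contactForm (ρ p) (fderiv ℝ ρ p v) = 0 →
    g.sq (ρ p) (fderiv ℝ ρ p v) = η.σ p v ^ 2 + η.θ₁ p v ^ 2

end ContactPath

end

open ContactPath

open ContactPath

namespace ContactPath

/-! In a canonical coframe `α = (2/3) β`. Components of `d²θ₀ = 0` and `d²σ = 0` show that `α` has
no `σ` and `θ₃` parts, so `β = -3 (W₀ θ₀ + W₁ θ₁ + W₂ θ₂)`.

Existence of `g`: the forms `σ, θ₀, θ₁` vanish on the fibres of `ρ`. Modulo `θ₀`, the derivative of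
`σ² + θ₁²` along a vertical `v` is `2 α(v) σ² + 2 (β - α)(v) θ₁²`, because the `θ₂(v)` terms of `dσ`
and `dθ₁` form an infinitesimal rotation. Both coefficients are multiples of `W₂`, so for `W₂ = 0`
the form is constant along the connected fibres and descends (`exists_metric`, via
`exists_contDiffOn_comp_eq`).

Geodesics: on curves annihilated by `θ₀`, `σ` may be replaced by `ω = σ - 2 W₁ θ₀`. With the
derivative of `W₁` along the paths, again from `d²θ₀ = 0` (`fderiv_W₁_frame`), the contraction of
`dω` with a path tangent `x` is `2 σ(x) (G₁ - 2 W₀) θ₀` (`extD_lengthForm`). A contact variation of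
a projected path lifts to `P`. Since `θ₁` vanishes on the path, only `ω` contributes to the first
variation. Exchanging derivatives and integrating by parts gives `∫ 2 |σ(γ')| (G₁ - 2 W₀) θ₀(V)`,
with `V` a lift of the variation field (`hasDerivAt_length`). One direction is then immediate. For
the other, there is a path through every point (`exists_path`), and contact variations realize bump
functions as contact component of the field (`exists_contactVariation`). -/

theorem exists_rightInverse_of_surjective {E F : Type*} [NormedAddCommGroup E] [NormedSpace ℝ E]
    [NormedAddCommGroup F] [NormedSpace ℝ F] [FiniteDimensional ℝ F] {A : E →L[ℝ] F}
    (hA : Function.Surjective A) : ∃ R : F →L[ℝ] E, ∀ y, A (R y) = y := by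
  obtain ⟨R, hR⟩ := A.toLinearMap.exists_rightInverse_of_surjective
    (LinearMap.range_eq_top.2 hA)
  exact ⟨LinearMap.toContinuousLinearMap R, fun y => LinearMap.congr_fun hR y⟩

/-! ### Submersions, descent along connected fibres, parameter integrals, integral curves -/

section Calculus

variable {E F : Type*} [NormedAddCommGroup E] [NormedSpace ℝ E] [CompleteSpace E]
  [NormedAddCommGroup F] [NormedSpace ℝ F] [CompleteSpace F]

/-- Near a point where the derivative of `f` has a right inverse, every point `x` can be moved
smoothly into the fibre over a given value `y`, points of that fibre staying fixed. -/
theorem exists_local_lift {f : E → F} {x₀ : E} (hf : ContDiffAt ℝ ∞ f x₀) (R : F →L[ℝ] E)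
    (hR : ∀ y, fderiv ℝ f x₀ (R y) = y) :
    ∃ Ψ : F × E → E, ContDiffAt ℝ ∞ Ψ (f x₀, x₀) ∧
      (∀ᶠ y in 𝓝 (f x₀, x₀), f (Ψ y) = y.1) ∧ ∀ᶠ x in 𝓝 x₀, Ψ (f x, x) = x := by
  set A : E →L[ℝ] F := fderiv ℝ f x₀ with hA
  -- Inverting `T` solves `f (x + R u) = y` for `u`, smoothly in `x` and `y`. The solution is `u =
  -- 0` when `y = f x`, which is why points already in the right fibre stay fixed.
  let T : E × F → E × F := fun q => (q.1, f (q.1 + R q.2))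
  let T' : (E × F) ≃L[ℝ] (E × F) := ContinuousLinearEquiv.equivOfInverse
    ((ContinuousLinearMap.fst ℝ E F).prod
      (A ∘L (ContinuousLinearMap.fst ℝ E F + R ∘L ContinuousLinearMap.snd ℝ E F)))
    ((ContinuousLinearMap.fst ℝ E F).prod
      (ContinuousLinearMap.snd ℝ E F - A ∘L ContinuousLinearMap.fst ℝ E F))
    (fun q => by simp [hR]) (fun q => by simp [hR])
  have hx : x₀ + R 0 = x₀ := by simp
  have hg : HasFDerivAt (fun q : E × F => q.1 + R q.2)
      (ContinuousLinearMap.fst ℝ E F + R ∘L ContinuousLinearMap.snd ℝ E F) (x₀, 0) :=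
    (ContinuousLinearMap.fst ℝ E F + R ∘L ContinuousLinearMap.snd ℝ E F).hasFDerivAt
  have hfd : HasFDerivAt f A (x₀ + R 0) := by
    rw [hx]; exact (hf.differentiableAt (by simp)).hasFDerivAt
  have hTd : HasFDerivAt T (T' : (E × F) →L[ℝ] (E × F)) (x₀, 0) :=
    (ContinuousLinearMap.fst ℝ E F).hasFDerivAt.prodMk (HasFDerivAt.comp (x₀, (0 : F)) hfd hg)
  have hT : ContDiffAt ℝ ∞ T (x₀, 0) := by
    refine contDiffAt_fst.prodMk (ContDiffAt.comp (x₀, (0 : F)) (g := f) ?_ (by fun_prop))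
    simpa using hf
  have hn : (∞ : WithTop ℕ∞) ≠ 0 := by simp
  have hs := hT.hasStrictFDerivAt' hTd hn
  have hT0 : T (x₀, 0) = (x₀, f x₀) := by simp [T]
  have hN := hT.to_localInverse hTd hn
  set N := hT.localInverse hTd hn with hNdef
  have hr : ∀ᶠ y in 𝓝 (T (x₀, 0)), T (N y) = y := hs.eventually_right_inverse
  have hl : ∀ᶠ x in 𝓝 (x₀, (0 : F)), N (T x) = x := hs.eventually_left_inverse
  rw [hT0] at hr hN
  refine ⟨fun y => y.2 + R (N (y.2, y.1)).2, ?_, ?_, ?_⟩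
  · have h1 : ContDiffAt ℝ ∞ (fun y : F × E => N (y.2, y.1)) (f x₀, x₀) :=
      ContDiffAt.comp (f x₀, x₀) (g := N) hN (by fun_prop)
    fun_prop
  · have hsw : Tendsto (fun y : F × E => (y.2, y.1)) (𝓝 (f x₀, x₀)) (𝓝 (x₀, f x₀)) :=
      (continuous_swap (X := F) (Y := E)).tendsto (f x₀, x₀)
    filter_upwards [hsw.eventually hr] with y hy
    have h1 := congrArg Prod.fst hy
    have h2 := congrArg Prod.snd hy
    simp only [T] at h1 h2
    rw [h1] at h2
    exact h2
  · have hc : Tendsto (fun x : E => (x, (0 : F))) (𝓝 x₀) (𝓝 (x₀, 0)) :=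
      (Continuous.prodMk_left (0 : F)).tendsto x₀
    filter_upwards [hc.eventually hl] with x hx'
    have : T (x, 0) = (x, f x) := by simp [T]
    rw [this] at hx'
    simp [hx']

/-- A function whose derivative vanishes along the fibres of a submersion with connected fibres
descends to the base. -/
theorem exists_contDiffOn_comp_eq [FiniteDimensional ℝ F] {P : Set E} {M : Set F} {ρ : E → F}
    (hPo : IsOpen P) (hρ : ContDiffOn ℝ ∞ ρ P) (hmaps : MapsTo ρ P M)
    (hsub : ∀ p ∈ P, Function.Surjective (fderiv ℝ ρ p))
    (hfib : ∀ x ∈ M, IsConnected (P ∩ ρ ⁻¹' {x})) {f : E → ℝ} (hf : ContDiffOn ℝ ∞ f P)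
    (hv : ∀ p ∈ P, ∀ v, fderiv ℝ ρ p v = 0 → fderiv ℝ f p v = 0) :
    ∃ k : F → ℝ, ContDiffOn ℝ ∞ k M ∧ ∀ p ∈ P, k (ρ p) = f p := by
  have key : ∀ p ∈ P, ∃ Ψ : F × E → E, ContDiffAt ℝ ∞ Ψ (ρ p, p) ∧ Ψ (ρ p, p) = p ∧
      (∀ᶠ y in 𝓝 (ρ p, p), ρ (Ψ y) = y.1) ∧ ∀ᶠ x in 𝓝 p, Ψ (ρ x, x) = x := by
    intro p hp
    obtain ⟨R, hR⟩ := exists_rightInverse_of_surjective (hsub p hp)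
    obtain ⟨Ψ, h1, h2, h3⟩ := exists_local_lift (hρ.contDiffAt (hPo.mem_nhds hp)) R hR
    exact ⟨Ψ, h1, h3.self_of_nhds, h2, h3⟩
  have hloc : ∀ p ∈ P, ∀ᶠ x in 𝓝 p, ρ x = ρ p → f x = f p := by
    intro p hp
    obtain ⟨Ψ, h1, h0, h2, h3⟩ := key p hp
    have hΨP : ∀ᶠ y in 𝓝 (ρ p, p), Ψ y ∈ P :=
      h1.continuousAt.eventually (by rw [h0]; exact hPo.mem_nhds hp)
    have hd : ∀ᶠ y in 𝓝 (ρ p, p), DifferentiableAt ℝ Ψ y :=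
      (h1.of_le (m := 1) (by simp)).eventually (by simp) |>.mono
        fun y hy => hy.differentiableAt (by simp)
    have hall := (hΨP.and (hd.and h2.eventually_nhds))
    have hcont : Tendsto (fun x : E => (ρ p, x)) (𝓝 p) (𝓝 (ρ p, p)) :=
      (Continuous.prodMk_right (ρ p)).tendsto p
    obtain ⟨ε, hε, hball⟩ := Metric.eventually_nhds_iff_ball.1 (hcont.eventually hall)
    -- The map `x ↦ Ψ (ρ p, x)` takes values in a single fibre, so its derivative is vertical and is
    -- killed by the derivative of `f`. Nearby points of the fibre of `p` are fixed by this map,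
    -- hence `f` agrees with `f p` on them.
    have hzero : ∀ x ∈ Metric.ball p ε, HasFDerivWithinAt (fun x => f (Ψ (ρ p, x))) (0 : E →L[ℝ] ℝ)
        (Metric.ball p ε) x := by
      intro x hx
      obtain ⟨hxP, hxd, hxe⟩ := hball x hx
      have hi : HasFDerivAt (fun x : E => (ρ p, x)) (ContinuousLinearMap.inr ℝ F E) x :=
        hasFDerivAt_prodMk_right (ρ p) x
      have hc := hxd.hasFDerivAt.comp x hi
      have hfx : HasFDerivAt f (fderiv ℝ f (Ψ (ρ p, x))) (Ψ (ρ p, x)) :=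
        ((hf.contDiffAt (hPo.mem_nhds hxP)).differentiableAt (by simp)).hasFDerivAt
      have hρx : HasFDerivAt ρ (fderiv ℝ ρ (Ψ (ρ p, x))) (Ψ (ρ p, x)) :=
        ((hρ.contDiffAt (hPo.mem_nhds hxP)).differentiableAt (by simp)).hasFDerivAt
      have h4 := hρx.comp x hc
      have h5 : HasFDerivAt (ρ ∘ (Ψ ∘ fun x : E => (ρ p, x))) (0 : E →L[ℝ] F) x := by
        refine (hasFDerivAt_const (ρ p) x).congr_of_eventuallyEq ?_
        have : Tendsto (fun x : E => (ρ p, x)) (𝓝 x) (𝓝 (ρ p, x)) :=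
          (Continuous.prodMk_right (ρ p)).tendsto x
        exact this.eventually hxe
      have h6 := h4.unique h5
      have h7 := hfx.comp x hc
      refine HasFDerivAt.hasFDerivWithinAt ?_
      convert! h7 using 1
      ext v
      exact (hv _ hxP _ (DFunLike.congr_fun h6 v)).symm
    filter_upwards [Metric.ball_mem_nhds p hε, h3] with x hx hx3 hxρ
    have hconst := (convex_ball p ε).is_const_of_fderivWithin_eq_zero (𝕜 := ℝ)
      (fun y hy => (hzero y hy).differentiableWithinAt)
      (fun y hy => (hzero y hy).fderivWithin (Metric.isOpen_ball.uniqueDiffWithinAt hy))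
      hx (Metric.mem_ball_self hε)
    simp only [h0] at hconst
    rw [← hxρ, hx3] at hconst
    exact hconst
  have hfibre : ∀ p ∈ P, ∀ p' ∈ P, ρ p = ρ p' → f p = f p' := by
    intro p hp p' hp' hpp
    have hconn := (hfib (ρ p) (hmaps hp)).isPreconnected
    have hS : ∀ x ∈ P ∩ ρ ⁻¹' {ρ p}, ∀ᶠ y in 𝓝[P ∩ ρ ⁻¹' {ρ p}] x, f x = f y := by
      rintro x ⟨hxP, hxρ⟩
      have := hloc x hxP
      filter_upwards [mem_nhdsWithin_of_mem_nhds this, self_mem_nhdsWithin] with y hy hy2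
      refine (hy ?_).symm
      have h1 : ρ x = ρ p := hxρ
      have h2 : ρ y = ρ p := hy2.2
      rw [h1, h2]
    exact hconn.induction₂ (fun x y => f x = f y) hS (fun _ _ _ _ _ _ h1 h2 => h1.trans h2)
      (fun _ _ _ _ h => h.symm) ⟨hp, rfl⟩ ⟨hp', hpp.symm⟩
  have hex : ∀ x ∈ M, ∃ p ∈ P, ρ p = x := fun x hx => (hfib x hx).nonempty
  choose! s hs using hex
  refine ⟨fun x => f (s x), ?_, fun p hp =>
    hfibre _ (hs _ (hmaps hp)).1 _ hp (hs _ (hmaps hp)).2⟩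
  intro x hx
  -- With its second argument frozen at `s x`, `Ψ` is a smooth local section of `ρ`. It may replace
  -- the arbitrary choice `s` because `f` is constant on fibres.
  obtain ⟨Ψ, h1, h0, h2, h3⟩ := key _ (hs x hx).1
  rw [(hs x hx).2] at h1 h0 h2
  have hΨP : ∀ᶠ y in 𝓝 (x, s x), Ψ y ∈ P :=
    h1.continuousAt.eventually (by rw [h0]; exact hPo.mem_nhds (hs x hx).1)
  have hcont : Tendsto (fun y : F => (y, s x)) (𝓝 x) (𝓝 (x, s x)) :=
    (Continuous.prodMk_left (s x)).tendsto x
  have hsm : ContDiffAt ℝ ∞ (fun y => f (Ψ (y, s x))) x := by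
    refine ContDiffAt.comp x (g := f) (f := fun y => Ψ (y, s x)) ?_
      (ContDiffAt.comp x (g := Ψ) h1 (by fun_prop))
    rw [h0]; exact hf.contDiffAt (hPo.mem_nhds (hs x hx).1)
  refine hsm.contDiffWithinAt.congr_of_eventuallyEq_of_mem ?_ hx
  filter_upwards [mem_nhdsWithin_of_mem_nhds (hcont.eventually (hΨP.and h2)), self_mem_nhdsWithin]
    with y hy hyM
  exact hfibre _ (hs y hyM).1 _ hy.1 ((hs y hyM).2.trans hy.2.symm)

/-- Differentiation under the integral sign for an integrand that is `C¹` near the segment of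
integration. -/
theorem hasDerivAt_integral_of_contDiffOn {f : ℝ × ℝ → ℝ} {U : Set (ℝ × ℝ)} (hU : IsOpen U)
    (hf : ContDiffOn ℝ 1 f U) {a b : ℝ} (hab : a ≤ b) (hsub : ∀ t ∈ Icc a b, (0, t) ∈ U) :
    HasDerivAt (fun s => ∫ t in a..b, f (s, t)) (∫ t in a..b, fderiv ℝ f (0, t) (1, 0)) 0 := by
  -- The tube lemma yields a compact rectangle inside `U`, on which the `s`-derivative is bounded.
  -- That constant is the dominating function.
  obtain ⟨u, v, hu, hv, h0u, hIv, huv⟩ := generalized_tube_lemma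
    (isCompact_singleton (x := (0 : ℝ))) (isCompact_Icc (a := a) (b := b)) hU
    (by rintro ⟨s, t⟩ ⟨rfl : s = 0, ht⟩; exact hsub t ht)
  obtain ⟨δ, hδ, hδu⟩ := Metric.nhds_basis_closedBall.mem_iff.1
    (hu.mem_nhds (singleton_subset_iff.1 h0u))
  have hK : Metric.closedBall (0 : ℝ) δ ×ˢ Icc a b ⊆ U :=
    (prod_mono hδu hIv).trans huv
  have hd : ContinuousOn (fun x => fderiv ℝ f x (1, 0)) U :=
    (hf.continuousOn_fderiv_of_isOpen hU le_rfl).clm_apply continuousOn_const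
  obtain ⟨C, hC⟩ := ((isCompact_closedBall (0 : ℝ) δ).prod
    (isCompact_Icc (a := a) (b := b))).exists_bound_of_continuousOn (hd.mono hK)
  have hIoc : uIoc a b ⊆ Icc a b := by rw [uIoc_of_le hab]; exact Ioc_subset_Icc_self
  have hslice : ∀ s ∈ Metric.closedBall (0 : ℝ) δ, ∀ g : ℝ × ℝ → ℝ, ContinuousOn g U →
      ContinuousOn (fun t => g (s, t)) (Icc a b) := fun s hs g hg =>
    hg.comp (by fun_prop) fun t ht => hK ⟨hs, ht⟩
  have hmeas : ∀ s ∈ Metric.closedBall (0 : ℝ) δ, ∀ g : ℝ × ℝ → ℝ, ContinuousOn g U →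
      MeasureTheory.AEStronglyMeasurable (fun t => g (s, t))
        (MeasureTheory.volume.restrict (uIoc a b)) := fun s hs g hg =>
    ((hslice s hs g hg).mono hIoc).aestronglyMeasurable measurableSet_uIoc
  have h0 : (0 : ℝ) ∈ Metric.closedBall (0 : ℝ) δ := Metric.mem_closedBall_self hδ.le
  refine (intervalIntegral.hasDerivAt_integral_of_dominated_loc_of_deriv_le
    (F := fun s t => f (s, t)) (F' := fun s t => fderiv ℝ f (s, t) (1, 0)) (bound := fun _ => C)
    (Metric.closedBall_mem_nhds (0 : ℝ) hδ) ?_ ?_ (hmeas 0 h0 _ hd) ?_ (by simp) ?_).2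
  · filter_upwards [Metric.closedBall_mem_nhds (0 : ℝ) hδ] with s hs
    exact hmeas s hs _ hf.continuousOn
  · exact ContinuousOn.intervalIntegrable (by
      rw [uIcc_of_le hab]; exact hslice 0 h0 _ hf.continuousOn)
  · exact Eventually.of_forall fun t ht s hs => hC (s, t) ⟨hs, hIoc ht⟩
  · refine Eventually.of_forall fun t ht s hs => ?_
    have hx : (s, t) ∈ U := hK ⟨hs, hIoc ht⟩
    have h1 := ((hf.contDiffAt (hU.mem_nhds hx)).differentiableAt (by simp)).hasFDerivAt
    have h2 : HasDerivAt (fun s : ℝ => (s, t)) ((1 : ℝ), (0 : ℝ)) s :=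
      (hasDerivAt_id s).prodMk (hasDerivAt_const s t)
    exact h1.comp_hasDerivAt s h2

/-- Smooth integral curves of a vector field that is smooth near a point. -/
theorem exists_contDiffOn_integralCurve {X : E → E} {p : E}
    (hX : ∀ᶠ q in 𝓝 p, ContDiffAt ℝ ∞ X q) {S : Set E} (hS : S ∈ 𝓝 p) :
    ∃ γ : ℝ → E, ∃ ε > 0, γ 0 = p ∧ ContDiffOn ℝ ∞ γ (Ioo (-ε) ε) ∧
      ∀ t ∈ Ioo (-ε) ε, γ t ∈ S ∧ HasDerivAt γ (X (γ t)) t := by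
  have hX1 : ContDiffAt ℝ 1 X p := hX.self_of_nhds.of_le (by simp)
  obtain ⟨γ, h0, ε, hε, hγ⟩ :=
    hX1.exists_forall_mem_closedBall_exists_eq_forall_mem_Ioo_hasDerivAt₀ 0
  simp only [zero_sub, zero_add] at hγ
  have hc : ContinuousAt γ 0 := (hγ 0 ⟨by linarith, hε⟩).continuousAt
  have hev : ∀ᶠ t in 𝓝 (0 : ℝ), γ t ∈ S ∧ ContDiffAt ℝ ∞ X (γ t) :=
    hc.eventually (by rw [h0]; exact (Filter.eventually_mem_set.2 hS).and hX)
  obtain ⟨δ, hδ, hball⟩ := Metric.eventually_nhds_iff_ball.1 hev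
  have hmem : ∀ t ∈ Ioo (-(min ε δ)) (min ε δ), t ∈ Ioo (-ε) ε ∧ t ∈ Metric.ball (0 : ℝ) δ := by
    intro t ht
    have h1 := min_le_left ε δ
    have h2 := min_le_right ε δ
    refine ⟨⟨by linarith [ht.1], by linarith [ht.2]⟩, ?_⟩
    rw [Metric.mem_ball, Real.dist_eq, sub_zero, abs_lt]
    exact ⟨by linarith [ht.1], by linarith [ht.2]⟩
  refine ⟨γ, min ε δ, lt_min hε hδ, h0, ?_, fun t ht =>
    ⟨(hball t (hmem t ht).2).1, hγ t (hmem t ht).1⟩⟩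
  rw [contDiffOn_infty]
  intro n
  have hd : DifferentiableOn ℝ γ (Ioo (-(min ε δ)) (min ε δ)) := fun t ht =>
    (hγ t (hmem t ht).1).differentiableAt.differentiableWithinAt
  -- Bootstrapping: `γ' = X ∘ γ` is as smooth as `γ`, so each round gains one derivative.
  induction n with
  | zero => exact contDiffOn_zero.2 hd.continuousOn
  | succ n ih =>
    push_cast
    rw [contDiffOn_succ_iff_deriv_of_isOpen isOpen_Ioo]
    refine ⟨hd, by simp, ?_⟩
    have hcomp : ContDiffOn ℝ n (fun t => X (γ t)) (Ioo (-(min ε δ)) (min ε δ)) := fun t ht =>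
      (((hball t (hmem t ht).2).2.of_le (by exact_mod_cast le_top)).comp_contDiffWithinAt t
        (ih t ht))
    exact hcomp.congr fun t ht => (hγ t (hmem t ht).1).deriv

end Calculus

/-! ### The exterior derivative -/

theorem two_le_infty : (2 : WithTop ℕ∞) ≤ ∞ := by
  exact WithTop.coe_le_coe.2 (le_top (a := (2 : ℕ∞)))

theorem _root_.ContDiffAt.differentiableAt_fderiv {E F : Type*} [NormedAddCommGroup E]
    [NormedSpace ℝ E] [NormedAddCommGroup F] [NormedSpace ℝ F] {f : E → F} {x : E}
    (hf : ContDiffAt ℝ ∞ f x) : DifferentiableAt ℝ (fderiv ℝ f) x :=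
  (hf.fderiv_right (m := 1) (by rw [one_add_one_eq_two]; exact two_le_infty)).differentiableAt
    (by simp)

/-- The antisymmetrized derivative of the pullback of `s` by the derivative of `f`. -/
theorem fderiv_comp_fderiv_sub {E F : Type*} [NormedAddCommGroup E] [NormedSpace ℝ E]
    [NormedAddCommGroup F] [NormedSpace ℝ F] {f : E → F} {s : E → F →L[ℝ] ℝ} {x : E}
    (hs : DifferentiableAt ℝ s x) (hf : ContDiffAt ℝ ∞ f x) (v w : E) :
    fderiv ℝ (fun y => s y (fderiv ℝ f y w)) x v - fderiv ℝ (fun y => s y (fderiv ℝ f y v)) x w =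
      fderiv ℝ s x v (fderiv ℝ f x w) - fderiv ℝ s x w (fderiv ℝ f x v) := by
  have hd : DifferentiableAt ℝ (fderiv ℝ f) x :=
    hf.differentiableAt_fderiv
  have h : ∀ u : E, fderiv ℝ (fun y => s y (fderiv ℝ f y u)) x =
      s x ∘L (fderiv ℝ (fderiv ℝ f) x).flip u + (fderiv ℝ s x).flip (fderiv ℝ f x u) := by
    intro u
    rw [fderiv_clm_apply hs (hd.clm_apply (differentiableAt_const u)),
      fderiv_clm_apply hd (differentiableAt_const u)]
    simp
  -- The terms containing the second derivative of `f` are symmetric in `v` and `w`, so they cancel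
  -- in the difference.
  have hsymm := (hf.of_le (m := minSmoothness ℝ 2) (by simpa using two_le_infty)).isSymmSndFDerivAt
    le_rfl v w
  rw [h v, h w]
  simp [hsymm]

/-- Only the derivative of the coefficients `s` survives antisymmetrization. If `v` is vertical one
of the two terms drops out, and `dϑ(v, w)` becomes a derivative of `s` along the fibre. -/
theorem extD_eq_of_factor {m n : ℕ} {ϑ : OneForm n} {f : Vec n → Vec m} {s : Vec n → Covec m}
    {p : Vec n} (hs : DifferentiableAt ℝ s p) (hf : ContDiffAt ℝ ∞ f p)
    (hϑ : DifferentiableAt ℝ ϑ p) (h : ∀ᶠ q in 𝓝 p, ϑ q = s q ∘L fderiv ℝ f q) (v w : Vec n) :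
    extD ϑ p v w = fderiv ℝ s p v (fderiv ℝ f p w) - fderiv ℝ s p w (fderiv ℝ f p v) := by
  have e : ∀ u : Vec n, (fderiv ℝ ϑ p).flip u = fderiv ℝ (fun y => s y (fderiv ℝ f y u)) p := by
    intro u
    have h1 : (fun y => s y (fderiv ℝ f y u)) =ᶠ[𝓝 p] fun y => ϑ y u := by
      filter_upwards [h] with y hy
      rw [hy]; rfl
    rw [h1.fderiv_eq, fderiv_clm_apply hϑ (differentiableAt_const u)]
    simp
  rw [extD_apply hϑ, ← fderiv_comp_fderiv_sub hs hf v w, ← e, ← e]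
  simp

/-- The exterior derivative of `φ ⋏ ψ`, that is, of the 2-form `dφ ⋏ ψ - φ ⋏ dψ`. -/
noncomputable def extDWedge {n : ℕ} (φ ψ : OneForm n) (p u v w : Vec n) : ℝ :=
  extD φ p u v * ψ p w + extD φ p v w * ψ p u + extD φ p w u * ψ p v
    - (φ p u * extD ψ p v w + φ p v * extD ψ p w u + φ p w * extD ψ p u v)

theorem hasFDerivAt_wedge_apply {n : ℕ} {φ ψ : OneForm n} {p : Vec n} (hφ : DifferentiableAt ℝ φ p)
    (hψ : DifferentiableAt ℝ ψ p) (v w : Vec n) :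
    HasFDerivAt (fun q => (φ q ⋏ ψ q) v w)
      ((φ p v • (fderiv ℝ ψ p).flip w + ψ p w • (fderiv ℝ φ p).flip v)
        - (φ p w • (fderiv ℝ ψ p).flip v + ψ p v • (fderiv ℝ φ p).flip w)) p := by
  have h : ∀ {θ : OneForm n}, DifferentiableAt ℝ θ p → ∀ u : Vec n,
      HasFDerivAt (fun q => θ q u) ((fderiv ℝ θ p).flip u) p := by
    intro θ hθ u
    convert! hθ.hasFDerivAt.clm_apply (hasFDerivAt_const u p) using 1
    simp
  exact ((h hφ v).mul (h hψ w)).sub ((h hφ w).mul (h hψ v))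

/-- `d² = 0` for a 1-form whose exterior derivative is a sum of wedge products. -/
theorem sum_extDWedge_eq_zero {n : ℕ} {ι : Type*} [Fintype ι] {ϑ : OneForm n}
    {φ ψ : ι → OneForm n} {p : Vec n} (hϑ : ContDiffAt ℝ ∞ ϑ p)
    (hφ : ∀ i, DifferentiableAt ℝ (φ i) p) (hψ : ∀ i, DifferentiableAt ℝ (ψ i) p)
    (h : ∀ᶠ q in 𝓝 p, ∀ v w, extD ϑ q v w = ∑ i, (φ i q ⋏ ψ i q) v w) (u v w : Vec n) :
    ∑ i, extDWedge (φ i) (ψ i) p u v w = 0 := by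
  have hd : DifferentiableAt ℝ (fderiv ℝ ϑ) p :=
    hϑ.differentiableAt_fderiv
  have hev : ∀ᶠ q in 𝓝 p, DifferentiableAt ℝ ϑ q :=
    ((hϑ.of_le (m := 1) (by simp)).eventually (by simp)).mono
      fun q hq => hq.differentiableAt (by simp)
  have h2 : ∀ x y : Vec n, HasFDerivAt (fun q => fderiv ℝ ϑ q x y)
      (((fderiv ℝ (fderiv ℝ ϑ) p).flip x).flip y) p := by
    intro x y
    convert! (hd.hasFDerivAt.clm_apply (hasFDerivAt_const x p)).clm_apply
      (hasFDerivAt_const y p) using 1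
    ext; simp
  have key : ∀ x y z : Vec n, fderiv ℝ (fderiv ℝ ϑ) p x y z - fderiv ℝ (fderiv ℝ ϑ) p x z y =
      ∑ i, ((φ i p y * fderiv ℝ (ψ i) p x z + ψ i p z * fderiv ℝ (φ i) p x y)
        - (φ i p z * fderiv ℝ (ψ i) p x y + ψ i p y * fderiv ℝ (φ i) p x z)) := by
    intro x y z
    have h3 := (h2 y z).sub (h2 z y)
    have h4 := HasFDerivAt.fun_sum (u := Finset.univ)
      fun i (_ : i ∈ Finset.univ) => hasFDerivAt_wedge_apply (hφ i) (hψ i) y z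
    have h5 := h3.congr_of_eventuallyEq
      (f₁ := fun q => ∑ i, (φ i q ⋏ ψ i q) y z) (by
        filter_upwards [h, hev] with q hq hq'
        rw [← hq, extD_apply hq']; rfl)
    have h6 := DFunLike.congr_fun (h5.unique h4) x
    simpa using h6
  have hsymm := (hϑ.of_le (m := minSmoothness ℝ 2) (by simpa using two_le_infty)).isSymmSndFDerivAt
    le_rfl
  -- In the cyclic sum the six second derivatives of `ϑ` cancel in pairs by symmetry in the two
  -- directions of differentiation.
  have hu := key u v w
  have hv := key v w u
  have hw := key w u v
  rw [hsymm u v] at hu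
  rw [hsymm v w] at hv
  rw [hsymm w u] at hw
  have hsum := congrArg₂ (· + ·) (congrArg₂ (· + ·) hu hv) hw
  simp only [← Finset.sum_add_distrib] at hsum
  have hz : ∑ i, extDWedge (φ i) (ψ i) p u v w =
      (fderiv ℝ (fderiv ℝ ϑ) p v u w - fderiv ℝ (fderiv ℝ ϑ) p u w v +
        (fderiv ℝ (fderiv ℝ ϑ) p w v u - fderiv ℝ (fderiv ℝ ϑ) p v u w)) +
        (fderiv ℝ (fderiv ℝ ϑ) p u w v - fderiv ℝ (fderiv ℝ ϑ) p w v u) := by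
    rw [hsum]
    refine Finset.sum_congr rfl fun i _ => ?_
    simp only [extDWedge, extD_apply (hφ i), extD_apply (hψ i)]
    ring
  rw [hz]; ring

/-! ### The dual frame -/

/-- The values of the five forms of a coframe on a tangent vector. -/
noncomputable def Coframe.toCLM (η : Coframe) (p : Vec 5) : Vec 5 →L[ℝ] Vec 5 :=
  ContinuousLinearMap.pi ![η.σ p, η.θ₀ p, η.θ₁ p, η.θ₂ p, η.θ₃ p]

/-- The frame dual to a coframe. -/
noncomputable def Coframe.frame (η : Coframe) (j : Fin 5) (p : Vec 5) : Vec 5 :=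
  (η.toCLM p).inverse (Pi.single j 1)

section Adapted

variable {P : Set (Vec 5)} {M : Set (Vec 3)} {ρ : Vec 5 → Vec 3}
  {L : Vec 5 → Submodule ℝ (Vec 5)} {η : Coframe}

/-- Five independent covectors span the dual of `ℝ⁵`, so their common zeros are killed by every
coordinate function. -/
theorem Coframe.IsAdapted.eq_zero_of_forms (hη : η.IsAdapted P ρ L) {p : Vec 5} (hp : p ∈ P)
    {v : Vec 5} (hσ : η.σ p v = 0) (h0 : η.θ₀ p v = 0) (h1 : η.θ₁ p v = 0) (h2 : η.θ₂ p v = 0)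
    (h3 : η.θ₃ p v = 0) : v = 0 := by
  have hfin : Module.finrank ℝ (Covec 5) = 5 := by
    rw [← (LinearMap.toContinuousLinearMap (𝕜 := ℝ) (E := Vec 5) (F' := ℝ)).finrank_eq]
    simp
  have hspan := (hη.linearIndependent p hp).span_eq_top_of_card_eq_finrank' (by simp [hfin])
  have hle : Submodule.span ℝ (range ![η.σ p, η.θ₀ p, η.θ₁ p, η.θ₂ p, η.θ₃ p]) ≤
      ann (Submodule.span ℝ {v}) := by
    rw [Submodule.span_le]
    rintro φ ⟨i, rfl⟩ u hu
    obtain ⟨c, rfl⟩ := Submodule.mem_span_singleton.1 hu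
    fin_cases i <;> simp [hσ, h0, h1, h2, h3]
  ext i
  have : ContinuousLinearMap.proj (R := ℝ) (φ := fun _ : Fin 5 => ℝ) i ∈
      ann (Submodule.span ℝ {v}) := hle (by rw [hspan]; trivial)
  exact this v (Submodule.mem_span_singleton_self v)

theorem Coframe.IsAdapted.isInvertible_toCLM (hη : η.IsAdapted P ρ L) {p : Vec 5} (hp : p ∈ P) :
    (η.toCLM p).IsInvertible := by
  have hinj : Function.Injective (η.toCLM p).toLinearMap := by
    rw [← LinearMap.ker_eq_bot, LinearMap.ker_eq_bot']
    intro v hv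
    have h : ∀ i, η.toCLM p v i = 0 := fun i => congrFun hv i
    exact hη.eq_zero_of_forms hp (h 0) (h 1) (h 2) (h 3) (h 4)
  refine ⟨(LinearEquiv.ofInjectiveEndo _ hinj).toContinuousLinearEquiv, ?_⟩
  ext v; rfl

theorem Coframe.IsAdapted.toCLM_frame (hη : η.IsAdapted P ρ L) {p : Vec 5} (hp : p ∈ P)
    (j : Fin 5) : η.toCLM p (η.frame j p) = Pi.single j 1 :=
  (hη.isInvertible_toCLM hp).self_apply_inverse _

theorem Coframe.IsAdapted.contDiffOn_frame (hη : η.IsAdapted P ρ L) (hP : IsOpen P) (j : Fin 5) :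
    ContDiffOn ℝ ∞ (η.frame j) P := by
  have h1 : ContDiffOn ℝ ∞ η.toCLM P := by
    obtain ⟨a, b, c, d, e⟩ := hη.smooth
    refine contDiffOn_clm_apply.2 fun v => contDiffOn_pi.2 fun i => ?_
    fin_cases i
    exacts [a.clm_apply contDiffOn_const, b.clm_apply contDiffOn_const,
      c.clm_apply contDiffOn_const, d.clm_apply contDiffOn_const, e.clm_apply contDiffOn_const]
  exact fun p hp => ((((hη.isInvertible_toCLM hp).contDiffAt_map_inverse (n := ∞)).comp p
    (h1.contDiffAt (hP.mem_nhds hp))).clm_apply contDiffAt_const).contDiffWithinAt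

end Adapted

/-! ### Consequences of the structure equations and of `d² = 0` -/

section Adapted

variable {P : Set (Vec 5)} {M : Set (Vec 3)} {ρ : Vec 5 → Vec 3}
  {L : Vec 5 → Submodule ℝ (Vec 5)} {η : Coframe}

theorem Coframe.IsAdapted.σ_frame (hη : η.IsAdapted P ρ L) {p : Vec 5} (hp : p ∈ P)
    (j : Fin 5) : η.σ p (η.frame j p) = (Pi.single j 1 : Vec 5) 0 :=
  congrFun (hη.toCLM_frame hp j) 0

theorem Coframe.IsAdapted.θ₀_frame (hη : η.IsAdapted P ρ L) {p : Vec 5} (hp : p ∈ P)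
    (j : Fin 5) : η.θ₀ p (η.frame j p) = (Pi.single j 1 : Vec 5) 1 :=
  congrFun (hη.toCLM_frame hp j) 1

theorem Coframe.IsAdapted.θ₁_frame (hη : η.IsAdapted P ρ L) {p : Vec 5} (hp : p ∈ P)
    (j : Fin 5) : η.θ₁ p (η.frame j p) = (Pi.single j 1 : Vec 5) 2 :=
  congrFun (hη.toCLM_frame hp j) 2

theorem Coframe.IsAdapted.θ₂_frame (hη : η.IsAdapted P ρ L) {p : Vec 5} (hp : p ∈ P)
    (j : Fin 5) : η.θ₂ p (η.frame j p) = (Pi.single j 1 : Vec 5) 3 :=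
  congrFun (hη.toCLM_frame hp j) 3

theorem Coframe.IsAdapted.θ₃_frame (hη : η.IsAdapted P ρ L) {p : Vec 5} (hp : p ∈ P)
    (j : Fin 5) : η.θ₃ p (η.frame j p) = (Pi.single j 1 : Vec 5) 4 :=
  congrFun (hη.toCLM_frame hp j) 4

/-- The coefficients of a smooth 1-form in a smooth coframe are smooth. -/
theorem Coframe.IsAdapted.contDiffOn_apply_frame (hη : η.IsAdapted P ρ L) (hP : IsOpen P)
    {φ : OneForm 5} (hφ : ContDiffOn ℝ ∞ φ P) (j : Fin 5) :
    ContDiffOn ℝ ∞ (fun p => φ p (η.frame j p)) P :=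
  hφ.clm_apply (hη.contDiffOn_frame hP j)

/-- The normalization `T₄ = -1` leaves the term `θ₂ ⋏ θ₁`, which pairs with `σ ⋏ θ₂` in `dθ₁` to
form a rotation of `(σ, θ₁)` along the fibres. This selects `σ² + θ₁²` as the form that can descend.
-/
theorem Coframe.StructureEquations.extD_σ {C : ConnectionData}
    (hC : η.StructureEquations C P) (hvar : C.IsVariational P) (hcan : C.IsCanonical P)
    {p : Vec 5} (hp : p ∈ P) (v w : Vec 5) : extD η.σ p v w =
      (C.α p ⋏ η.σ p) v w + (η.θ₀ p ⋏ (C.T₁ p • η.θ₁ p + C.T₃ p • η.θ₃ p)) v w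
        + (η.θ₂ p ⋏ η.θ₁ p) v w := by
  rw [hC.d_σ p hp, (hvar p hp).2.1, (hcan p hp).1, (hcan p hp).2.1]
  simp [wedge]
  ring

variable {C : ConnectionData}

theorem differentiableAt_of_isOpen {n : ℕ} {G : Type*} [NormedAddCommGroup G] [NormedSpace ℝ G]
    {U : Set (Vec n)} {f : Vec n → G} (hU : IsOpen U)
    (hf : ContDiffOn ℝ ∞ f U) {p : Vec n} (hp : p ∈ U) : DifferentiableAt ℝ f p :=
  (hf.contDiffAt (hU.mem_nhds hp)).differentiableAt (by simp)

/-- `d²σ = 0`. -/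
theorem Coframe.StructureEquations.extDWedge_σ (hP : IsOpen P) (hη : η.IsAdapted P ρ L)
    (hC : η.StructureEquations C P) (hvar : C.IsVariational P) (hcan : C.IsCanonical P)
    {p : Vec 5} (hp : p ∈ P) (u v w : Vec 5) :
    extDWedge C.α η.σ p u v w
      + extDWedge η.θ₀ (fun q => C.T₁ q • η.θ₁ q + C.T₃ q • η.θ₃ q) p u v w
      + extDWedge η.θ₂ η.θ₁ p u v w = 0 := by
  obtain ⟨sσ, s0, s1, s2, s3⟩ := hη.smooth
  have hμ : DifferentiableAt ℝ (fun q => C.T₁ q • η.θ₁ q + C.T₃ q • η.θ₃ q) p :=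
    differentiableAt_of_isOpen hP ((hC.smooth_torsion.2.2.1.smul s1).add
      (hC.smooth_torsion.2.2.2.2.1.smul s3)) hp
  have hd : ∀ {φ : OneForm 5}, ContDiffOn ℝ ∞ φ P → DifferentiableAt ℝ φ p :=
    fun h => differentiableAt_of_isOpen hP h hp
  have h := sum_extDWedge_eq_zero (ϑ := η.σ) (p := p)
    (φ := ![C.α, η.θ₀, η.θ₂])
    (ψ := ![η.σ, fun q => C.T₁ q • η.θ₁ q + C.T₃ q • η.θ₃ q, η.θ₁])
    (sσ.contDiffAt (hP.mem_nhds hp))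
    (fun i => by
      fin_cases i
      exacts [hd hC.smooth_forms.1, hd s0, hd s2])
    (fun i => by
      fin_cases i
      exacts [hd sσ, hμ, hd s1])
    (by
      filter_upwards [hP.mem_nhds hp] with q hq v w
      rw [hC.extD_σ hvar hcan hq]
      simp [Fin.sum_univ_three]) u v w
  simpa [Fin.sum_univ_three] using h

/-- `d²θ₀ = 0`. -/
theorem Coframe.StructureEquations.extDWedge_θ₀ (hP : IsOpen P) (hη : η.IsAdapted P ρ L)
    (hC : η.StructureEquations C P) {p : Vec 5} (hp : p ∈ P) (u v w : Vec 5) :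
    extDWedge C.β η.θ₀ p u v w + extDWedge η.σ η.θ₁ p u v w = 0 := by
  obtain ⟨sσ, s0, s1, s2, s3⟩ := hη.smooth
  have hd : ∀ {φ : OneForm 5}, ContDiffOn ℝ ∞ φ P → DifferentiableAt ℝ φ p :=
    fun h => differentiableAt_of_isOpen hP h hp
  have h := sum_extDWedge_eq_zero (ϑ := η.θ₀) (p := p)
    (φ := ![C.β, η.σ]) (ψ := ![η.θ₀, η.θ₁])
    (s0.contDiffAt (hP.mem_nhds hp))
    (fun i => by
      fin_cases i
      exacts [hd hC.smooth_forms.2.1, hd sσ])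
    (fun i => by
      fin_cases i
      exacts [hd s0, hd s1])
    (by
      filter_upwards [hP.mem_nhds hp] with q hq v w
      rw [hC.d_θ₀ q hq]
      simp [Fin.sum_univ_two]) u v w
  simpa [Fin.sum_univ_two] using h

theorem extD_eq_smul {n : ℕ} {φ ψ : OneForm n} {p : Vec n} (hψ : DifferentiableAt ℝ ψ p) {c : ℝ}
    (h : φ =ᶠ[𝓝 p] fun q => c • ψ q) (v w : Vec n) : extD φ p v w = c * extD ψ p v w := by
  have h1 : HasFDerivAt φ (c • fderiv ℝ ψ p) p :=
    (hψ.hasFDerivAt.const_smul c).congr_of_eventuallyEq h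
  rw [extD_apply h1.differentiableAt, extD_apply hψ, h1.fderiv]
  simp only [smul_apply, smul_eq_mul]
  ring

theorem ConnectionData.IsCanonical.α_eq (hcan : C.IsCanonical P) {p : Vec 5} (hp : p ∈ P) :
    C.α p = (2 / 3 : ℝ) • C.β p := by
  have h := (hcan p hp).2.2
  ext v
  have h1 := DFunLike.congr_fun h v
  simp only [sub_apply, smul_apply, smul_eq_mul, zero_apply] at h1 ⊢
  linarith

/-- Along a canonical coframe `α` has no components in the directions of `σ` and `θ₃`. -/
theorem Coframe.StructureEquations.α_frame (hP : IsOpen P) (hη : η.IsAdapted P ρ L)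
    (hC : η.StructureEquations C P) (hvar : C.IsVariational P) (hcan : C.IsCanonical P)
    {p : Vec 5} (hp : p ∈ P) :
    C.α p (η.frame 0 p) = 0 ∧ C.α p (η.frame 4 p) = 0 := by
  have hαβ := hcan.α_eq hp
  have hdα : ∀ v w, extD C.α p v w = 2 / 3 * extD C.β p v w :=
    extD_eq_smul (differentiableAt_of_isOpen hP hC.smooth_forms.2.1 hp)
      (by filter_upwards [hP.mem_nhds hp] with q hq using hcan.α_eq hq)
  -- Write `e₀, …, e₄` for the frame. The first component gives `dβ(e₂, e₃) = 0`, hence `dα(e₂, e₃)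
  -- = 0`. In the two components of `d²σ` the terms with `2β - 3α` vanish, and what remains is
  -- `α(e₀) = 0` and `α(e₄) = 0`.
  have e0 := hC.extDWedge_θ₀ hP hη hp (η.frame 1 p) (η.frame 2 p) (η.frame 3 p)
  have e1 := hC.extDWedge_σ hP hη hvar hcan hp (η.frame 0 p) (η.frame 2 p) (η.frame 3 p)
  have e2 := hC.extDWedge_σ hP hη hvar hcan hp (η.frame 2 p) (η.frame 3 p) (η.frame 4 p)
  simp only [extDWedge, hC.extD_σ hvar hcan hp, hC.d_θ₀ p hp, hC.d_θ₁ p hp, hC.d_θ₂ p hp, wedge,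
    Pi.add_apply, Pi.smul_apply, add_apply, sub_apply, smul_apply, smul_eq_mul, hdα, hαβ,
    hη.σ_frame hp, hη.θ₀_frame hp, hη.θ₁_frame hp, hη.θ₂_frame hp, hη.θ₃_frame hp,
    Pi.single_apply, Fin.reduceEq, if_true, if_false] at e0 e1 e2 ⊢
  constructor <;> linarith

theorem Coframe.IsAdapted.eq_sum_frame (hη : η.IsAdapted P ρ L) {p : Vec 5} (hp : p ∈ P)
    (v : Vec 5) : v = η.σ p v • η.frame 0 p + η.θ₀ p v • η.frame 1 p + η.θ₁ p v • η.frame 2 p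
      + η.θ₂ p v • η.frame 3 p + η.θ₃ p v • η.frame 4 p := by
  rw [← sub_eq_zero]
  apply hη.eq_zero_of_forms hp <;>
  simp [hη.σ_frame hp, hη.θ₀_frame hp, hη.θ₁_frame hp, hη.θ₂_frame hp, hη.θ₃_frame hp]

/-- The connection forms `α` and `β` in terms of `W₀, W₁, W₂`. -/
theorem Coframe.IsExpansionW.β_eq (hP : IsOpen P) (hη : η.IsAdapted P ρ L)
    (hC : η.StructureEquations C P) (hvar : C.IsVariational P) (hcan : C.IsCanonical P)
    {W₀ W₁ W₂ : Vec 5 → ℝ} (hW : η.IsExpansionW C P W₀ W₁ W₂) {p : Vec 5} (hp : p ∈ P) :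
    C.β p = (-3 : ℝ) • (W₀ p • η.θ₀ p + W₁ p • η.θ₁ p + W₂ p • η.θ₂ p) := by
  obtain ⟨a, b, hab⟩ := hW p hp
  obtain ⟨h0, h4⟩ := hC.α_frame hP hη hvar hcan hp
  rw [hcan.α_eq hp] at hab h0 h4
  have hv := fun v => DFunLike.congr_fun hab v
  have ha := hv (η.frame 0 p)
  have hb := hv (η.frame 4 p)
  simp [hη.σ_frame hp, hη.θ₀_frame hp, hη.θ₁_frame hp, hη.θ₂_frame hp, hη.θ₃_frame hp] at ha hb h0 h4
  rw [h0] at ha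
  rw [h4] at hb
  have ha' : a = 0 := by linarith
  have hb' : b = 0 := by linarith
  ext v
  have := hv v
  simp [ha', hb'] at this ⊢
  linarith

theorem Coframe.IsExpansionW.contDiffOn (hP : IsOpen P) (hη : η.IsAdapted P ρ L)
    (hC : η.StructureEquations C P) (hvar : C.IsVariational P) (hcan : C.IsCanonical P)
    {W₀ W₁ W₂ : Vec 5 → ℝ} (hW : η.IsExpansionW C P W₀ W₁ W₂) :
    ContDiffOn ℝ ∞ W₀ P ∧ ContDiffOn ℝ ∞ W₁ P := by
  have h := fun j => ((hη.contDiffOn_apply_frame hP hC.smooth_forms.2.1 j).const_smul (-1 / 3 : ℝ))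
  constructor
  · refine (h 1).congr fun p hp => ?_
    simp [hW.β_eq hP hη hC hvar hcan hp, hη.θ₀_frame hp, hη.θ₁_frame hp, hη.θ₂_frame hp]
    ring
  · refine (h 2).congr fun p hp => ?_
    simp [hW.β_eq hP hη hC hvar hcan hp, hη.θ₀_frame hp, hη.θ₁_frame hp, hη.θ₂_frame hp]
    ring

theorem Coframe.IsExpansionG.contDiffOn (hP : IsOpen P) (hη : η.IsAdapted P ρ L)
    (hC : η.StructureEquations C P) {H G₀ G₁ G₂ G₃ : Vec 5 → ℝ}
    (hG : η.IsExpansionG C P H G₀ G₁ G₂ G₃) : ContDiffOn ℝ ∞ G₁ P := by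
  refine ((hη.contDiffOn_apply_frame hP hC.smooth_forms.2.2 2).const_smul (-1 / 3 : ℝ)).congr
    fun p hp => ?_
  simp [hG p hp, hη.σ_frame hp, hη.θ₀_frame hp, hη.θ₁_frame hp, hη.θ₂_frame hp, hη.θ₃_frame hp]
  ring

theorem extD_smul {n : ℕ} {f : Vec n → ℝ} {θ : OneForm n} {p : Vec n}
    (hf : DifferentiableAt ℝ f p) (hθ : DifferentiableAt ℝ θ p) (v w : Vec n) :
    extD (fun q => f q • θ q) p v w =
      f p * extD θ p v w + (fderiv ℝ f p v * θ p w - fderiv ℝ f p w * θ p v) := by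
  rw [extD_apply (hf.fun_smul hθ), extD_apply hθ, fderiv_fun_smul hf hθ]
  simp
  ring

theorem extD_add {n : ℕ} {φ ψ : OneForm n} {p : Vec n}
    (hφ : DifferentiableAt ℝ φ p) (hψ : DifferentiableAt ℝ ψ p) (v w : Vec n) :
    extD (fun q => φ q + ψ q) p v w = extD φ p v w + extD ψ p v w := by
  rw [extD_apply (hφ.fun_add hψ), extD_apply hφ, extD_apply hψ, fderiv_fun_add hφ hψ]
  simp
  ring

/-- The derivative of `W₁` along the paths. -/
theorem fderiv_W₁_frame (hP : IsOpen P) (hη : η.IsAdapted P ρ L)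
    (hC : η.StructureEquations C P) (hvar : C.IsVariational P) (hcan : C.IsCanonical P)
    {W₀ W₁ W₂ : Vec 5 → ℝ} (hW : η.IsExpansionW C P W₀ W₁ W₂)
    {H G₀ G₁ G₂ G₃ : Vec 5 → ℝ} (hG : η.IsExpansionG C P H G₀ G₁ G₂ G₃)
    (hW₂ : ∀ p ∈ P, W₂ p = 0) {p : Vec 5} (hp : p ∈ P) :
    fderiv ℝ W₁ p (η.frame 0 p) = G₁ p - W₀ p := by
  obtain ⟨sσ, s0, s1, s2, s3⟩ := hη.smooth
  obtain ⟨hW0, hW1⟩ := hW.contDiffOn hP hη hC hvar hcan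
  have d0 := differentiableAt_of_isOpen hP hW0 hp
  have d1 := differentiableAt_of_isOpen hP hW1 hp
  have t0 := differentiableAt_of_isOpen hP s0 hp
  have t1 := differentiableAt_of_isOpen hP s1 hp
  have hβ : ∀ q ∈ P, C.β q = (-3 : ℝ) • (W₀ q • η.θ₀ q + W₁ q • η.θ₁ q) := fun q hq => by
    rw [hW.β_eq hP hη hC hvar hcan hq, hW₂ q hq, zero_smul, add_zero]
  have hdβ : ∀ v w, extD C.β p v w = -3 * extD (fun q => W₀ q • η.θ₀ q + W₁ q • η.θ₁ q) p v w :=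
    extD_eq_smul ((d0.smul t0).add (d1.smul t1))
      (by filter_upwards [hP.mem_nhds hp] with q hq using hβ q hq)
  -- This component of `d²θ₀` contains `dβ(e₀, e₂)`, which brings in the derivative of `W₁` along
  -- `e₀`, and the `θ₁`-coefficient of `γ` through `σ ⋏ dθ₁`, which brings in `G₁`.
  have e0 := hC.extDWedge_θ₀ hP hη hp (η.frame 1 p) (η.frame 0 p) (η.frame 2 p)
  simp only [extDWedge, hdβ, extD_add (d0.fun_smul t0) (d1.fun_smul t1),
    extD_smul d0 t0, extD_smul d1 t1,
    hC.extD_σ hvar hcan hp, hC.d_θ₀ p hp, hC.d_θ₁ p hp, wedge,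
    Pi.add_apply, add_apply, sub_apply, smul_apply, smul_eq_mul,
    hcan.α_eq hp, hβ p hp, hG p hp,
    hη.σ_frame hp, hη.θ₀_frame hp, hη.θ₁_frame hp, hη.θ₂_frame hp, hη.θ₃_frame hp,
    Pi.single_apply, Fin.reduceEq, if_true, if_false] at e0
  linarith

end Adapted

/-! ### The contact planes of `ℝ³` -/

/-- The contact vector field `∂_x + z ∂_y`. -/
def contactX (q : Vec 3) : Vec 3 := ![1, q 2, 0]

theorem contactForm_apply (q u : Vec 3) : contactForm q u = u 1 - q 2 * u 0 := by
  simp [contactForm]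

theorem eq_add_contactForm_smul (q u : Vec 3) :
    u = u 0 • contactX q + u 2 • (![0, 0, 1] : Vec 3) + contactForm q u • (![0, 1, 0] : Vec 3) := by
  ext i
  fin_cases i <;> simp [contactX, contactForm_apply]
  ring

theorem contactForm_contactX (q : Vec 3) : contactForm q (contactX q) = 0 := by
  simp [contactForm_apply, contactX]

theorem contactForm_dz (q : Vec 3) : contactForm q ![0, 0, 1] = 0 := by
  simp [contactForm_apply]

theorem differentiable_contactX : Differentiable ℝ contactX := by
  refine differentiable_pi.2 fun i => ?_
  fin_cases i
  exacts [differentiable_const _, differentiable_apply (2 : Fin 3), differentiable_const _]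

theorem contDiff_contactX : ContDiff ℝ ∞ contactX := by
  refine contDiff_pi.2 fun i => ?_
  fin_cases i
  exacts [contDiff_const, contDiff_apply ℝ ℝ (2 : Fin 3), contDiff_const]

/-! ### Semibasic 1-forms of a submersion -/

section Factor

variable {m n : ℕ} {P : Set (Vec n)} {ρ : Vec n → Vec m}

/-- A smooth 1-form that vanishes on the fibres of a submersion is the composition of its
differential with a smooth field of covectors of the base. -/
theorem exists_factor (hP : IsOpen P) (hρ : ContDiffOn ℝ ∞ ρ P)
    (hsub : ∀ p ∈ P, Function.Surjective (fderiv ℝ ρ p)) {ϑ : OneForm n}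
    (hϑ : ContDiffOn ℝ ∞ ϑ P) (hker : ∀ p ∈ P, ∀ v, fderiv ℝ ρ p v = 0 → ϑ p v = 0) :
    ∃ s : Vec n → Covec m, ContDiffOn ℝ ∞ s P ∧ ∀ p ∈ P, ϑ p = s p ∘L fderiv ℝ ρ p := by
  have hR : ∀ p ∈ P, ∃ R : Vec m →L[ℝ] Vec n, ∀ y, fderiv ℝ ρ p (R y) = y := fun p hp =>
    exists_rightInverse_of_surjective (hsub p hp)
  choose! R hR using hR
  have hdiff : ∀ p ∈ P, ∀ v w, fderiv ℝ ρ p v = fderiv ℝ ρ p w → ϑ p v = ϑ p w := by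
    intro p hp v w h
    rw [← sub_eq_zero, ← map_sub]
    exact hker p hp _ (by rw [map_sub, h, sub_self])
  refine ⟨fun p => ϑ p ∘L R p, ?_, fun p hp => ?_⟩
  · intro p hp
    obtain ⟨Ψ, h1, h2, h3⟩ := exists_local_lift (hρ.contDiffAt (hP.mem_nhds hp)) (R p) (hR p hp)
    have hcont : ContinuousAt (fun q => (ρ q, q)) p :=
      ((hρ.contDiffAt (hP.mem_nhds hp)).continuousAt).prodMk continuousAt_id
    have hd : ∀ᶠ y in 𝓝 (ρ p, p), DifferentiableAt ℝ Ψ y :=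
      ((h1.of_le (m := 1) (by simp)).eventually (by simp)).mono
        fun y hy => hy.differentiableAt (by simp)
    -- By `hdiff` the choice of right inverse does not affect `ϑ p ∘L R p`. The derivative of `Ψ` in
    -- the base direction is another right inverse near `p`, and it varies smoothly.
    have hsm : ContDiffAt ℝ ∞
        (fun q => ϑ q ∘L (fderiv ℝ Ψ (ρ q, q) ∘L ContinuousLinearMap.inl ℝ (Vec m) (Vec n))) p := by
      have h4 : ContDiffAt ℝ ∞ (fun q => fderiv ℝ Ψ (ρ q, q)) p :=
        ContDiffAt.comp p (g := fderiv ℝ Ψ) (f := fun q => (ρ q, q))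
          (h1.fderiv_right (m := ∞) (by simp))
          ((hρ.contDiffAt (hP.mem_nhds hp)).prodMk contDiffAt_id)
      exact (hϑ.contDiffAt (hP.mem_nhds hp)).clm_comp (h4.clm_comp contDiffAt_const)
    refine (hsm.congr_of_eventuallyEq ?_).contDiffWithinAt
    filter_upwards [hP.mem_nhds hp, hcont.eventually (hd.and h2.eventually_nhds), h3]
      with q hq hqd hq3
    ext1 u
    refine hdiff q hq _ _ ?_
    refine (hR q hq u).trans ?_
    have h5 : HasFDerivAt (fun y => ρ (Ψ y)) (ContinuousLinearMap.fst ℝ (Vec m) (Vec n)) (ρ q, q) :=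
      hasFDerivAt_fst.congr_of_eventuallyEq hqd.2
    have h6 : HasFDerivAt ρ (fderiv ℝ ρ q) (Ψ (ρ q, q)) := by
      rw [hq3]; exact (differentiableAt_of_isOpen hP hρ hq).hasFDerivAt
    have h7 := DFunLike.congr_fun (h5.unique (h6.comp (ρ q, q) hqd.1.hasFDerivAt)) (u, 0)
    exact h7
  · ext v
    refine hdiff p hp _ _ ?_
    simp [hR p hp]

/-- The derivative along the fibres of the components of a covector field of the base. -/
theorem fderiv_factor_apply (hP : IsOpen P) (hρ : ContDiffOn ℝ ∞ ρ P) {ϑ : OneForm n}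
    (hϑ : ContDiffOn ℝ ∞ ϑ P) {s : Vec n → Covec m} (hs : ContDiffOn ℝ ∞ s P)
    (h : ∀ p ∈ P, ϑ p = s p ∘L fderiv ℝ ρ p) {Y : Vec m → Vec m} (hY : Differentiable ℝ Y)
    {p : Vec n} (hp : p ∈ P) {v w : Vec n} (hv : fderiv ℝ ρ p v = 0)
    (hw : fderiv ℝ ρ p w = Y (ρ p)) :
    fderiv ℝ (fun q => s q (Y (ρ q))) p v = extD ϑ p v w := by
  have hsd := differentiableAt_of_isOpen hP hs hp
  have hρd := differentiableAt_of_isOpen hP hρ hp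
  have h1 : HasFDerivAt (fun q => Y (ρ q)) (fderiv ℝ Y (ρ p) ∘L fderiv ℝ ρ p) p :=
    (hY (ρ p)).hasFDerivAt.comp p hρd.hasFDerivAt
  -- Since `v` is vertical, both the term of `dϑ` pairing with its projection and the variation of
  -- `Y ∘ ρ` along `v` vanish.
  rw [extD_eq_of_factor hsd (hρ.contDiffAt (hP.mem_nhds hp)) (differentiableAt_of_isOpen hP hϑ hp)
    (by filter_upwards [hP.mem_nhds hp] with q hq using h q hq), hv, hw,
    fderiv_clm_apply hsd h1.differentiableAt, h1.fderiv]
  simp [hv]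

end Factor

/-! ### Descent of `σ² + θ₁²` to the base -/

section Adapted

variable {P : Set (Vec 5)} {M : Set (Vec 3)} {ρ : Vec 5 → Vec 3}
  {L : Vec 5 → Submodule ℝ (Vec 5)} {η : Coframe} {C : ConnectionData}

theorem Coframe.IsAdapted.θ₀_vertical (hη : η.IsAdapted P ρ L) {p : Vec 5} (hp : p ∈ P)
    {v : Vec 5} (hv : fderiv ℝ ρ p v = 0) : η.θ₀ p v = 0 :=
  (hη.contact p hp v).1 (by simp [hv])

theorem Coframe.IsAdapted.θ₁_vertical (hη : η.IsAdapted P ρ L) {p : Vec 5} (hp : p ∈ P)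
    {v : Vec 5} (hv : fderiv ℝ ρ p v = 0) : η.θ₁ p v = 0 := by
  have h : η.θ₁ p ∈ systemI ρ L p := by
    rw [hη.span_I p hp]; exact Submodule.subset_span (by simp)
  exact h v (Submodule.mem_sup_right hv)

/-- `θ₀` and the pulled-back contact form have the same kernel, so they are proportional. The factor
is what converts the contact component of a variation field into a value of `θ₀`. -/
theorem exists_factor_θ₀ (hP : IsContactPathGeometry P M ρ L) (hη : η.IsAdapted P ρ L) :
    ∃ h : Vec 5 → ℝ, ContDiffOn ℝ ∞ h P ∧ (∀ p ∈ P, h p ≠ 0) ∧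
      ∀ p ∈ P, ∀ v, η.θ₀ p v = h p * contactForm (ρ p) (fderiv ℝ ρ p v) := by
  obtain ⟨s, hs, hfac⟩ := exists_factor hP.isOpen_P hP.smooth hP.submersion hη.smooth.2.1
    fun p hp v hv => hη.θ₀_vertical hp hv
  have hzero : ∀ p ∈ P, ∀ u, contactForm (ρ p) u = 0 → s p u = 0 := by
    intro p hp u hu
    obtain ⟨w, rfl⟩ := hP.submersion p hp u
    have := (hη.contact p hp w).1 hu
    rwa [hfac p hp] at this
  have hmul : ∀ p ∈ P, ∀ v,
      η.θ₀ p v = s p ![0, 1, 0] * contactForm (ρ p) (fderiv ℝ ρ p v) := by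
    intro p hp v
    rw [hfac p hp, ContinuousLinearMap.comp_apply,
      eq_add_contactForm_smul (ρ p) (fderiv ℝ ρ p v)]
    simp only [map_add, map_smul, hzero p hp _ (contactForm_contactX _),
      hzero p hp _ (contactForm_dz _), contactForm_contactX, contactForm_dz]
    simp [contactForm_apply, mul_comm]
  refine ⟨fun p => s p ![0, 1, 0], hs.clm_apply contDiffOn_const, fun p hp h0 => ?_, hmul⟩
  have h1 := hmul p hp (η.frame 1 p)
  rw [show s p ![0, 1, 0] = 0 from h0, hη.θ₀_frame hp] at h1
  simp at h1

/-- `θ₀` is semibasic and vanishes on lifts of contact fields, so `dθ₀(v, w) = 0` for `v` vertical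
and `w` projecting to a contact vector. The structure equation turns this into `σ(v) θ₁(w) = 0`, and
`θ₁` is non-zero on some such `w`. -/
theorem Coframe.StructureEquations.σ_vertical (hP : IsContactPathGeometry P M ρ L)
    (hη : η.IsAdapted P ρ L) (hC : η.StructureEquations C P) {p : Vec 5} (hp : p ∈ P)
    {v : Vec 5} (hv : fderiv ℝ ρ p v = 0) : η.σ p v = 0 := by
  obtain ⟨s, hs, hfac⟩ := exists_factor hP.isOpen_P hP.smooth hP.submersion hη.smooth.2.1
    fun p hp v hv => hη.θ₀_vertical hp hv
  have hY : ∀ Y : Vec 3 → Vec 3, Differentiable ℝ Y → (∀ q, contactForm q (Y q) = 0) →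
      ∀ w, fderiv ℝ ρ p w = Y (ρ p) → extD η.θ₀ p v w = 0 := by
    intro Y hYd hYc w hw
    rw [← fderiv_factor_apply hP.isOpen_P hP.smooth hη.smooth.2.1 hs hfac hYd hp hv hw]
    have h0 : (fun q => s q (Y (ρ q))) =ᶠ[𝓝 p] fun _ => (0 : ℝ) := by
      filter_upwards [hP.isOpen_P.mem_nhds hp] with q hq
      obtain ⟨w', hw'⟩ := hP.submersion q hq (Y (ρ q))
      have h1 := (hη.contact q hq w').1 (by rw [hw', hYc])
      rwa [hfac q hq, ContinuousLinearMap.comp_apply, hw'] at h1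
    rw [h0.fderiv_eq]; simp
  obtain ⟨w₁, hw₁⟩ := hP.submersion p hp (contactX (ρ p))
  obtain ⟨w₂, hw₂⟩ := hP.submersion p hp ![0, 0, 1]
  have e₁ := hY _ differentiable_contactX contactForm_contactX w₁ hw₁
  have e₂ := hY _ (differentiable_const ![0, 0, 1]) contactForm_dz w₂ hw₂
  have c₁ := (hη.contact p hp w₁).1 (by rw [hw₁, contactForm_contactX])
  have c₂ := (hη.contact p hp w₂).1 (by rw [hw₂, contactForm_dz])
  -- Modulo a vertical vector, `η.frame 2 p` is a combination of `w₁` and `w₂`. As `θ₁` takes the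
  -- value 1 on it, `θ₁` cannot vanish on both.
  have hdρ : fderiv ℝ ρ p (η.frame 2 p - (fderiv ℝ ρ p (η.frame 2 p) 0 • w₁
      + fderiv ℝ ρ p (η.frame 2 p) 2 • w₂)) = 0 := by
    have hc : contactForm (ρ p) (fderiv ℝ ρ p (η.frame 2 p)) = 0 :=
      (hη.contact p hp _).2 (by simp [hη.θ₀_frame hp])
    have h1 := eq_add_contactForm_smul (ρ p) (fderiv ℝ ρ p (η.frame 2 p))
    rw [hc, zero_smul, add_zero] at h1
    rw [map_sub, map_add, map_smul, map_smul, hw₁, hw₂, ← h1, sub_self]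
  have h1 := hη.θ₁_vertical hp hdρ
  rw [hC.d_θ₀ p hp] at e₁ e₂
  simp only [wedge, Pi.add_apply, hη.θ₀_vertical hp hv, hη.θ₁_vertical hp hv, c₁, c₂, mul_zero,
    sub_zero, zero_add] at e₁ e₂
  simp only [map_sub, map_add, map_smul, hη.θ₁_frame hp, smul_eq_mul, Pi.single_eq_same] at h1
  linear_combination η.σ p v * h1 + fderiv ℝ ρ p (η.frame 2 p) 0 * e₁
    + fderiv ℝ ρ p (η.frame 2 p) 2 * e₂

/-- The quadratic form `σ² + θ₁²` descends to a sub-Riemannian metric. -/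
theorem exists_metric (hP : IsContactPathGeometry P M ρ L) (hη : η.IsAdapted P ρ L)
    (hC : η.StructureEquations C P) (hvar : C.IsVariational P) (hcan : C.IsCanonical P)
    {W₀ W₁ W₂ : Vec 5 → ℝ} (hW : η.IsExpansionW C P W₀ W₁ W₂) (hW₂ : ∀ p ∈ P, W₂ p = 0) :
    ∃ g : SubRiemannianMetric M, g.IsDefinedBy η P ρ := by
  obtain ⟨sσ, s0, s1, s2, s3⟩ := hη.smooth
  obtain ⟨s, hs, hsf⟩ := exists_factor hP.isOpen_P hP.smooth hP.submersion sσ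
    fun p hp v hv => hC.σ_vertical hP hη hp hv
  obtain ⟨t, ht, htf⟩ := exists_factor hP.isOpen_P hP.smooth hP.submersion s1
    fun p hp v hv => hη.θ₁_vertical hp hv
  -- The coefficients of the metric are the values of the polarized form on pairs of contact fields,
  -- so each of them is made to descend.
  have hdesc : ∀ Y Z : Vec 3 → Vec 3, ContDiff ℝ ∞ Y → ContDiff ℝ ∞ Z →
      (∀ q, contactForm q (Y q) = 0) → (∀ q, contactForm q (Z q) = 0) →
      ∃ k : Vec 3 → ℝ, ContDiffOn ℝ ∞ k M ∧ ∀ p ∈ P, k (ρ p) =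
        s p (Y (ρ p)) * s p (Z (ρ p)) + t p (Y (ρ p)) * t p (Z (ρ p)) := by
    intro Y Z hY hZ hYc hZc
    have sm : ∀ {r : Vec 5 → Covec 3}, ContDiffOn ℝ ∞ r P → ∀ {Y : Vec 3 → Vec 3},
        ContDiff ℝ ∞ Y → ContDiffOn ℝ ∞ (fun p => r p (Y (ρ p))) P := fun hr _ hY =>
      hr.clm_apply (hY.comp_contDiffOn hP.smooth)
    have a := sm hs hY
    have b := sm hs hZ
    have c := sm ht hY
    have d := sm ht hZ
    refine exists_contDiffOn_comp_eq hP.isOpen_P hP.smooth hP.mapsTo hP.submersion hP.fibre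
      ((a.mul b).add (c.mul d)) fun p hp v hv => ?_
    have hd : ∀ {f : Vec 5 → ℝ}, ContDiffOn ℝ ∞ f P → HasFDerivAt f (fderiv ℝ f p) p :=
      fun hf => (differentiableAt_of_isOpen hP.isOpen_P hf hp).hasFDerivAt
    obtain ⟨w₁, hw₁⟩ := hP.submersion p hp (Y (ρ p))
    obtain ⟨w₂, hw₂⟩ := hP.submersion p hp (Z (ρ p))
    have c₁ := (hη.contact p hp w₁).1 (by rw [hw₁, hYc])
    have c₂ := (hη.contact p hp w₂).1 (by rw [hw₂, hZc])
    have hYd : Differentiable ℝ Y := hY.differentiable (by simp)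
    have hZd : Differentiable ℝ Z := hZ.differentiable (by simp)
    have ea := fderiv_factor_apply hP.isOpen_P hP.smooth sσ hs hsf hYd hp hv hw₁
    have eb := fderiv_factor_apply hP.isOpen_P hP.smooth sσ hs hsf hZd hp hv hw₂
    have ec := fderiv_factor_apply hP.isOpen_P hP.smooth s1 ht htf hYd hp hv hw₁
    have ed := fderiv_factor_apply hP.isOpen_P hP.smooth s1 ht htf hZd hp hv hw₂
    have e := (((hd a).mul (hd b)).add ((hd c).mul (hd d))).fderiv
    have e' := DFunLike.congr_fun e v
    refine e'.trans ?_
    have vals : s p (Y (ρ p)) = η.σ p w₁ ∧ s p (Z (ρ p)) = η.σ p w₂ ∧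
        t p (Y (ρ p)) = η.θ₁ p w₁ ∧ t p (Z (ρ p)) = η.θ₁ p w₂ := by
      rw [hsf p hp, htf p hp]
      simp [hw₁, hw₂]
    -- The `θ₂(v)` terms of `dσ` and `dθ₁` cancel by skewness. The others carry `α(v)` or `(β -
    -- α)(v)`, which vanish because `W₂ = 0` and `θ₀, θ₁` vanish on `v`.
    simp only [add_apply, smul_apply, smul_eq_mul, ea, eb, ec, ed, vals, hC.extD_σ hvar hcan hp,
      hC.d_θ₁ p hp, wedge, Pi.add_apply, sub_apply, hcan.α_eq hp,
      hW.β_eq hP.isOpen_P hη hC hvar hcan hp, hW₂ p hp, hη.θ₀_vertical hp hv,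
      hη.θ₁_vertical hp hv, hC.σ_vertical hP hη hp hv, c₁, c₂]
    ring
  have hZ : ContDiff ℝ ∞ (fun _ : Vec 3 => (![0, 0, 1] : Vec 3)) := contDiff_const
  obtain ⟨E, hE, hEe⟩ := hdesc _ _ contDiff_contactX contDiff_contactX contactForm_contactX
    contactForm_contactX
  obtain ⟨F, hF, hFe⟩ := hdesc _ _ contDiff_contactX hZ contactForm_contactX contactForm_dz
  obtain ⟨G, hG, hGe⟩ := hdesc _ _ hZ hZ contactForm_dz contactForm_dz
  have hsq : ∀ p ∈ P, ∀ a b : ℝ,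
      E (ρ p) * a ^ 2 + 2 * F (ρ p) * a * b + G (ρ p) * b ^ 2 =
        s p (a • contactX (ρ p) + b • ![0, 0, 1]) ^ 2
          + t p (a • contactX (ρ p) + b • ![0, 0, 1]) ^ 2 := by
    intro p hp a b
    rw [hEe p hp, hFe p hp, hGe p hp]
    simp only [map_add, map_smul, smul_eq_mul]
    ring
  refine ⟨⟨E, fun q => 2 * F q, G, hE, contDiffOn_const.mul hF, hG, ?_⟩, ?_⟩
  · intro q hq a b hab
    obtain ⟨p, hp, rfl⟩ := (hP.fibre q hq).nonempty
    have hp : p ∈ P := hp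
    rw [hsq p hp]
    set u : Vec 3 := a • contactX (ρ p) + b • ![0, 0, 1] with hu
    obtain ⟨r, hr, hrf⟩ := exists_factor hP.isOpen_P hP.smooth hP.submersion s0
      fun p hp v hv => hη.θ₀_vertical hp hv
    -- `σ, θ₀, θ₁` induce three independent covectors on the base, so a contact vector on which `σ`
    -- and `θ₁` vanish is zero. This gives definiteness.
    let T : Vec 3 →ₗ[ℝ] Vec 3 := LinearMap.pi
      ![(s p).toLinearMap, (r p).toLinearMap, (t p).toLinearMap]
    have hsurj : Function.Surjective T := by
      intro y
      refine ⟨fderiv ℝ ρ p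
        (y 0 • η.frame 0 p + y 1 • η.frame 1 p + y 2 • η.frame 2 p), ?_⟩
      have h1 := fun x => (DFunLike.congr_fun (hsf p hp) x).symm
      have h2 := fun x => (DFunLike.congr_fun (hrf p hp) x).symm
      have h3 := fun x => (DFunLike.congr_fun (htf p hp) x).symm
      simp only [ContinuousLinearMap.comp_apply] at h1 h2 h3
      ext i
      fin_cases i <;> simp only [T, LinearMap.pi_apply] <;>
        simp [-map_add, -map_smul, h1, h2, h3]
      all_goals simp [hη.σ_frame hp, hη.θ₀_frame hp, hη.θ₁_frame hp]
    have hinj := LinearMap.injective_iff_surjective.2 hsurj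
    by_contra hneg
    have hs0 : s p u = 0 := by nlinarith [sq_nonneg (s p u), sq_nonneg (t p u)]
    have ht0 : t p u = 0 := by nlinarith [sq_nonneg (s p u), sq_nonneg (t p u)]
    have hr0 : r p u = 0 := by
      obtain ⟨w, hw⟩ := hP.submersion p hp u
      have h1 := (hη.contact p hp w).1 (by
        rw [hw, hu, map_add, map_smul, map_smul, contactForm_contactX, contactForm_dz]; simp)
      rwa [hrf p hp, ContinuousLinearMap.comp_apply, hw] at h1
    have hu0 : u = 0 := by
      refine hinj ?_
      rw [map_zero]
      ext i
      fin_cases i <;> simp [T, hs0, ht0, hr0]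
    apply hab
    have h0 := congrFun hu0 0
    have h2 := congrFun hu0 2
    simp [hu, contactX] at h0 h2
    rw [h0, h2]
  · intro p hp v hv
    have h1 := eq_add_contactForm_smul (ρ p) (fderiv ℝ ρ p v)
    rw [hv, zero_smul, add_zero] at h1
    rw [hsf p hp, htf p hp, ContinuousLinearMap.comp_apply, ContinuousLinearMap.comp_apply, h1,
      ← hsq p hp, ← h1]
    rfl

end Adapted

/-! ### First variation of the line element -/

section Adapted

variable {P : Set (Vec 5)} {M : Set (Vec 3)} {ρ : Vec 5 → Vec 3}
  {L : Vec 5 → Submodule ℝ (Vec 5)} {η : Coframe} {C : ConnectionData}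

theorem Coframe.IsAdapted.forms_of_mem (hη : η.IsAdapted P ρ L) {p : Vec 5} (hp : p ∈ P)
    {v : Vec 5} (hv : v ∈ L p) :
    η.θ₀ p v = 0 ∧ η.θ₁ p v = 0 ∧ η.θ₂ p v = 0 ∧ η.θ₃ p v = 0 := by
  have h : ∀ φ ∈ ({η.θ₀ p, η.θ₁ p, η.θ₂ p, η.θ₃ p} : Set (Covec 5)), φ v = 0 := by
    intro φ hφ
    have : φ ∈ ann (L p) := by rw [hη.span_L p hp]; exact Submodule.subset_span hφ
    exact this v hv
  exact ⟨h _ (by simp), h _ (by simp), h _ (by simp), h _ (by simp)⟩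

theorem Coframe.IsAdapted.σ_ne_zero (hη : η.IsAdapted P ρ L) {p : Vec 5} (hp : p ∈ P)
    {v : Vec 5} (hv : v ∈ L p) (h0 : v ≠ 0) : η.σ p v ≠ 0 := fun h =>
  let ⟨a, b, c, d⟩ := hη.forms_of_mem hp hv
  h0 (hη.eq_zero_of_forms hp h a b c d)

/-- The 1-form `σ - 2 W₁ θ₀`. -/
noncomputable def Coframe.lengthForm (η : Coframe) (W₁ : Vec 5 → ℝ) : OneForm 5 :=
  -- With the multiplier `-2 W₁`, the `θ₁` terms of `dσ` and of `-2 W₁ dθ₀` cancel upon contraction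
  -- with a path tangent.
  fun q => η.σ q + (-2 * W₁ q) • η.θ₀ q

/-- The contraction of `d(σ - 2 W₁ θ₀)` with a tangent vector of a path. -/
theorem extD_lengthForm (hP : IsOpen P) (hη : η.IsAdapted P ρ L)
    (hC : η.StructureEquations C P) (hvar : C.IsVariational P) (hcan : C.IsCanonical P)
    {W₀ W₁ W₂ : Vec 5 → ℝ} (hW : η.IsExpansionW C P W₀ W₁ W₂)
    {H G₀ G₁ G₂ G₃ : Vec 5 → ℝ} (hG : η.IsExpansionG C P H G₀ G₁ G₂ G₃)
    (hW₂ : ∀ p ∈ P, W₂ p = 0) {p : Vec 5} (hp : p ∈ P) {x : Vec 5} (hx : x ∈ L p) (w : Vec 5) :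
    extD (η.lengthForm W₁) p w x = 2 * η.σ p x * (G₁ p - 2 * W₀ p) * η.θ₀ p w := by
  obtain ⟨sσ, s0, s1, s2, s3⟩ := hη.smooth
  obtain ⟨hW0, hW1⟩ := hW.contDiffOn hP hη hC hvar hcan
  have d1 := differentiableAt_of_isOpen hP hW1 hp
  have t0 := differentiableAt_of_isOpen hP s0 hp
  have tσ := differentiableAt_of_isOpen hP sσ hp
  have dl : DifferentiableAt ℝ (fun q => -2 * W₁ q) p := d1.const_mul (-2)
  obtain ⟨x0, x1, x2, x3⟩ := hη.forms_of_mem hp hx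
  have hxX : x = η.σ p x • η.frame 0 p := by
    have := hη.eq_sum_frame hp x
    simpa [x0, x1, x2, x3] using this
  have hd : fderiv ℝ W₁ p x = η.σ p x * (G₁ p - W₀ p) := by
    rw [← fderiv_W₁_frame hP hη hC hvar hcan hW hG hW₂ hp]
    conv_lhs => rw [hxX]
    simp
  have hl : fderiv ℝ (fun q => -2 * W₁ q) p x = -2 * fderiv ℝ W₁ p x := by
    rw [fderiv_const_mul d1]; simp
  unfold Coframe.lengthForm
  rw [extD_add tσ (dl.fun_smul t0), extD_smul dl t0, hC.extD_σ hvar hcan hp, hC.d_θ₀ p hp]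
  simp only [wedge, Pi.add_apply, add_apply, smul_apply, smul_eq_mul, hcan.α_eq hp,
    hW.β_eq hP hη hC hvar hcan hp, hW₂ p hp, x0, x1, x2, x3, hl, hd]
  ring

/-- Since `g` vanishes at `x`, its square contributes nothing to first order. With `g` the `θ₁`
component of the velocity, the first variation sees only the length form. -/
theorem hasFDerivAt_sqrt_sq_add_sq {E : Type*} [NormedAddCommGroup E] [NormedSpace ℝ E]
    {f g : E → ℝ} {f' g' : E →L[ℝ] ℝ} {x : E} (hf : HasFDerivAt f f' x) (hg : HasFDerivAt g g' x)
    (hfx : f x ≠ 0) (hgx : g x = 0) :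
    HasFDerivAt (fun y => √(f y ^ 2 + g y ^ 2)) ((f x / |f x|) • f') x := by
  have h := ((hf.pow 2).add (hg.pow 2)).sqrt (by
    simp only [Pi.add_apply, hgx]; positivity)
  convert! h using 1
  ext v
  have h1 : |f x| ≠ 0 := abs_ne_zero.2 hfx
  simp [hgx, Real.sqrt_sq_eq_abs]
  field_simp

/-- The variational field of a variation. -/
noncomputable def variationField (Γ : ℝ × ℝ → Vec 3) (t : ℝ) : Vec 3 := fderiv ℝ Γ (0, t) (1, 0)

theorem IsContactVariation.deriv_eq {c : ℝ → Vec 3} {J : Set ℝ} {a b ε : ℝ} {Γ : ℝ × ℝ → Vec 3}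
    (hΓ : IsContactVariation M c J a b ε Γ) (hJ : IsOpen J) {s t : ℝ} (hs : s ∈ Ioo (-ε) ε)
    (ht : t ∈ J) : deriv (fun τ => Γ (s, τ)) t = fderiv ℝ Γ (s, t) (0, 1) := by
  have h1 := ((hΓ.smooth.contDiffAt ((isOpen_Ioo.prod hJ).mem_nhds (mk_mem_prod hs ht))).differentiableAt
    (by simp)).hasFDerivAt
  have h2 : HasDerivAt (fun τ : ℝ => (s, τ)) ((0 : ℝ), (1 : ℝ)) t :=
    (hasDerivAt_const t s).prodMk (hasDerivAt_id t)
  exact (h1.comp_hasDerivAt t h2).deriv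

/-- The first variation of the line element of a projected path, at one parameter value. -/
theorem fderiv_lineElement (hP : IsContactPathGeometry P M ρ L) (hη : η.IsAdapted P ρ L)
    (hC : η.StructureEquations C P) (hvar : C.IsVariational P) (hcan : C.IsCanonical P)
    {W₀ W₁ W₂ : Vec 5 → ℝ} (hW : η.IsExpansionW C P W₀ W₁ W₂)
    {H G₀ G₁ G₂ G₃ : Vec 5 → ℝ} (hG : η.IsExpansionG C P H G₀ G₁ G₂ G₃)
    (hW₂ : ∀ p ∈ P, W₂ p = 0) {g : SubRiemannianMetric M} (hg : g.IsDefinedBy η P ρ)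
    {h : Vec 5 → ℝ}
    (hh : ∀ p ∈ P, ∀ v, η.θ₀ p v = h p * contactForm (ρ p) (fderiv ℝ ρ p v))
    {s : Vec 5 → Covec 3} (hs : ∀ p ∈ P, η.lengthForm W₁ p = s p ∘L fderiv ℝ ρ p)
    {γ : ℝ → Vec 5} {J : Set ℝ} (hJ : IsOpen J) (hγ : IsPath P L γ J) {a b ε : ℝ} (hε : 0 < ε)
    {Γ : ℝ × ℝ → Vec 3} (hΓ : IsContactVariation M (ρ ∘ γ) J a b ε Γ) {t : ℝ} (ht : t ∈ J) :
    fderiv ℝ (fun x => √(g.sq (Γ x) (fderiv ℝ Γ x (0, 1)))) (0, t) (1, 0) =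
      η.σ (γ t) (deriv γ t) / |η.σ (γ t) (deriv γ t)| *
        (deriv (fun τ => s (γ τ) (variationField Γ τ)) t
          + 2 * η.σ (γ t) (deriv γ t) * (G₁ (γ t) - 2 * W₀ (γ t))
            * (h (γ t) * contactForm (ρ (γ t)) (variationField Γ t))) := by
  obtain ⟨sσ, s0, s1, s2, s3⟩ := hη.smooth
  obtain ⟨hW0, hW1⟩ := hW.contDiffOn hP.isOpen_P hη hC hvar hcan
  have hω : ContDiffOn ℝ ∞ (η.lengthForm W₁) P :=
    sσ.add ((contDiffOn_const.mul hW1).smul s0)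
  have h0ε : (0 : ℝ) ∈ Ioo (-ε) ε := ⟨by linarith, hε⟩
  have hU : IsOpen (Ioo (-ε) ε ×ˢ J) := isOpen_Ioo.prod hJ
  have hx₀ : ((0 : ℝ), t) ∈ Ioo (-ε) ε ×ˢ J := ⟨h0ε, ht⟩
  set p := γ t with hpdef
  have hp : p ∈ P := hγ.mem t ht
  have hPn := hP.isOpen_P.mem_nhds hp
  have hΓ0 : Γ (0, t) = ρ p := hΓ.zero t ht
  have hΓs : ContDiffAt ℝ ∞ Γ (0, t) := hΓ.smooth.contDiffAt (hU.mem_nhds hx₀)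
  have hγs : ContDiffAt ℝ ∞ γ t := hγ.smooth.contDiffAt (hJ.mem_nhds ht)
  obtain ⟨R, hR⟩ := exists_rightInverse_of_surjective (hP.submersion p hp)
  obtain ⟨Ψ, hΨ, hρΨ, hΨfix⟩ := exists_local_lift (hP.smooth.contDiffAt hPn) R hR
  -- the lift of the variation
  set N : ℝ × ℝ → Vec 5 := fun x => Ψ (Γ x, γ x.2) with hN
  have hpair : ContDiffAt ℝ ∞ (fun x : ℝ × ℝ => (Γ x, γ x.2)) (0, t) :=
    hΓs.prodMk (ContDiffAt.comp (0, t) (g := γ) hγs contDiffAt_snd)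
  have hNs : ContDiffAt ℝ ∞ N (0, t) := by
    refine ContDiffAt.comp (0, t) (g := Ψ) ?_ hpair
    simpa only [hΓ0] using hΨ
  have hN0 : N (0, t) = p := by
    simp only [hN, hΓ0]; exact hΨfix.self_of_nhds
  have hNd : ∀ᶠ x in 𝓝 ((0 : ℝ), t), DifferentiableAt ℝ N x :=
    ((hNs.of_le (m := 1) (by simp)).eventually (by simp)).mono
      fun y hy => hy.differentiableAt (by simp)
  have hNP : ∀ᶠ x in 𝓝 ((0 : ℝ), t), N x ∈ P :=
    hNs.continuousAt.eventually (by rw [hN0]; exact hPn)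
  have hρN : ∀ᶠ x in 𝓝 ((0 : ℝ), t), ρ (N x) = Γ x := by
    have hc := hpair.continuousAt
    exact hc.eventually (p := fun y => ρ (Ψ y) = y.1) (by simpa only [hΓ0] using hρΨ)
  have hdN : ∀ᶠ x in 𝓝 ((0 : ℝ), t), ∀ e, fderiv ℝ ρ (N x) (fderiv ℝ N x e) = fderiv ℝ Γ x e := by
    filter_upwards [hNd, hNP, hρN.eventually_nhds] with x hx hxP hxρ e
    have h1 := (differentiableAt_of_isOpen hP.isOpen_P hP.smooth hxP).hasFDerivAt.comp x hx.hasFDerivAt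
    have h2 : fderiv ℝ (ρ ∘ N) x = fderiv ℝ Γ x := Filter.EventuallyEq.fderiv_eq hxρ
    rw [← h2, h1.fderiv]
    rfl
  have hcon : ∀ᶠ x in 𝓝 ((0 : ℝ), t), contactForm (Γ x) (fderiv ℝ Γ x (0, 1)) = 0 := by
    filter_upwards [hU.mem_nhds hx₀] with x hx
    have := hΓ.contact x.1 hx.1 x.2 hx.2
    rwa [hΓ.deriv_eq hJ hx.1 hx.2] at this
  -- `Ψ` fixes points already in the prescribed fibre, so the central curve lifts to the path
  -- itself, on whose tangent all the `θ` forms vanish.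
  have hNγ : (fun τ => N (0, τ)) =ᶠ[𝓝 t] γ := by
    filter_upwards [hJ.mem_nhds ht, hγs.continuousAt.eventually hΨfix] with τ hτ hτ'
    have : Γ (0, τ) = ρ (γ τ) := hΓ.zero τ hτ
    simp only [hN, this]
    exact hτ'
  have hline : HasDerivAt (fun τ : ℝ => ((0 : ℝ), τ)) ((0 : ℝ), (1 : ℝ)) t :=
    (hasDerivAt_const t (0 : ℝ)).prodMk (hasDerivAt_id t)
  have hN2 : fderiv ℝ N (0, t) (0, 1) = deriv γ t := by
    rw [← hNγ.deriv_eq]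
    exact (((hNs.differentiableAt (by simp)).hasFDerivAt).comp_hasDerivAt t hline).deriv.symm
  have hLx : deriv γ t ∈ L p := hγ.tangent t ht
  obtain ⟨x0, x1, x2, x3⟩ := hη.forms_of_mem hp hLx
  have hσ0 : η.σ p (deriv γ t) ≠ 0 := hη.σ_ne_zero hp hLx (hγ.regular t ht)
  -- the forms along the lift
  have hcomp : ∀ {φ : OneForm 5}, ContDiffOn ℝ ∞ φ P →
      ContDiffAt ℝ ∞ (fun x => φ (N x)) (0, t) := fun {φ} hφ =>
    ContDiffAt.comp (0, t) (g := φ) (by rw [hN0]; exact hφ.contDiffAt hPn) hNs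
  have hdfd : DifferentiableAt ℝ (fderiv ℝ N) (0, t) := hNs.differentiableAt_fderiv
  have happ : ∀ {φ : OneForm 5}, ContDiffOn ℝ ∞ φ P → ∀ e : ℝ × ℝ,
      DifferentiableAt ℝ (fun x => φ (N x) (fderiv ℝ N x e)) (0, t) := fun hφ e =>
    ((hcomp hφ).differentiableAt (by simp)).clm_apply (hdfd.clm_apply (differentiableAt_const e))
  have hθ0 : ∀ᶠ x in 𝓝 ((0 : ℝ), t), η.θ₀ (N x) (fderiv ℝ N x (0, 1)) = 0 := by
    filter_upwards [hNP, hρN, hdN, hcon] with x h1 h2 h3 h4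
    refine (hη.contact _ h1 _).1 ?_
    rw [h2, h3, h4]
  have hsqrt : (fun x => √(g.sq (Γ x) (fderiv ℝ Γ x (0, 1)))) =ᶠ[𝓝 ((0 : ℝ), t)]
      fun x => √((η.lengthForm W₁ (N x) (fderiv ℝ N x (0, 1))) ^ 2
        + (η.θ₁ (N x) (fderiv ℝ N x (0, 1))) ^ 2) := by
    filter_upwards [hNP, hρN, hdN, hcon, hθ0] with x h1 h2 h3 h4 h5
    have h6 := hg _ h1 (fderiv ℝ N x (0, 1)) (by rw [h2, h3, h4])
    rw [h2, h3] at h6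
    simp [h6, Coframe.lengthForm, h5]
  have hAval : η.lengthForm W₁ (N (0, t)) (fderiv ℝ N (0, t) (0, 1)) = η.σ p (deriv γ t) := by
    rw [hN0, hN2]; simp [Coframe.lengthForm, x0]
  have hfd := hasFDerivAt_sqrt_sq_add_sq (happ hω (0, 1)).hasFDerivAt (happ s1 (0, 1)).hasFDerivAt
    (by rw [hAval]; exact hσ0) (by rw [hN0, hN2]; exact x1)
  rw [hsqrt.fderiv_eq, hfd.fderiv, hAval]
  simp only [smul_apply, smul_eq_mul]
  congr 1
  -- interchange of the two derivatives
  have hsub := fderiv_comp_fderiv_sub (s := fun x => η.lengthForm W₁ (N x))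
    ((hcomp hω).differentiableAt (by simp)) hNs (1, 0) (0, 1)
  have hωd : DifferentiableAt ℝ (η.lengthForm W₁) (N (0, t)) := by
    rw [hN0]; exact differentiableAt_of_isOpen hP.isOpen_P hω hp
  have hch : fderiv ℝ (fun x => η.lengthForm W₁ (N x)) (0, t) =
      fderiv ℝ (η.lengthForm W₁) (N (0, t)) ∘L fderiv ℝ N (0, t) :=
    (hωd.hasFDerivAt.comp (0, t) (hNs.differentiableAt (by simp)).hasFDerivAt).fderiv
  rw [hch] at hsub
  simp only [ContinuousLinearMap.comp_apply] at hsub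
  rw [← extD_apply hωd, hN2, hN0, extD_lengthForm hP.isOpen_P hη hC hvar hcan hW hG hW₂ hp hLx,
    hh p hp] at hsub
  have hV : fderiv ℝ ρ p (fderiv ℝ N (0, t) (1, 0)) = variationField Γ t := by
    have := hdN.self_of_nhds (1, 0)
    rwa [hN0] at this
  rw [hV] at hsub
  -- The length form is semibasic, so its value on the lifted variation field depends only on the
  -- field in the base and not on the local choice of lift.
  have hB : deriv (fun τ => s (γ τ) (variationField Γ τ)) t =
      fderiv ℝ (fun x => η.lengthForm W₁ (N x) (fderiv ℝ N x (1, 0))) (0, t) (0, 1) := by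
    have h1 := (happ hω (1, 0)).hasFDerivAt.comp_hasDerivAt t hline
    have h2 : (fun τ => s (γ τ) (variationField Γ τ)) =ᶠ[𝓝 t]
        ((fun x => η.lengthForm W₁ (N x) (fderiv ℝ N x (1, 0))) ∘ fun τ => ((0 : ℝ), τ)) := by
      have hcl : Tendsto (fun τ : ℝ => ((0 : ℝ), τ)) (𝓝 t) (𝓝 ((0 : ℝ), t)) :=
        (Continuous.prodMk_right (0 : ℝ)).tendsto t
      filter_upwards [hNγ, hcl.eventually hNP, hcl.eventually hdN] with τ h3 h4 h5
      have h3 : N (0, τ) = γ τ := h3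
      simp only [Function.comp_apply]
      rw [hs _ h4, ContinuousLinearMap.comp_apply, h5, h3]
      rfl
    rw [h2.deriv_eq, h1.deriv]
  rw [hB]
  linarith

end Adapted

/-! ### Contact variations and their variational fields -/

section Variation

variable {M : Set (Vec 3)}

theorem contDiffOn_variationField {c : ℝ → Vec 3} {J : Set ℝ} (hJ : IsOpen J) {a b ε : ℝ}
    (hε : 0 < ε) {Γ : ℝ × ℝ → Vec 3} (hΓ : IsContactVariation M c J a b ε Γ) :
    ContDiffOn ℝ ∞ (variationField Γ) J := by
  have h1 : ContDiffOn ℝ ∞ (fun x => fderiv ℝ Γ x (1, 0)) (Ioo (-ε) ε ×ˢ J) :=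
    (hΓ.smooth.fderiv_of_isOpen (isOpen_Ioo.prod hJ) (by simp)).clm_apply contDiffOn_const
  exact h1.comp (f := fun t : ℝ => ((0 : ℝ), t)) (by fun_prop)
    fun t ht => ⟨⟨by linarith, hε⟩, ht⟩

/-- Outside `Icc a b` the variation does not depend on `s`. The endpoints are limits of such
parameters, and vanishing there removes the boundary term of the integration by parts. -/
theorem variationField_eq_zero {c : ℝ → Vec 3} {J : Set ℝ} (hJ : IsOpen J) {a b ε : ℝ}
    (hε : 0 < ε) {Γ : ℝ × ℝ → Vec 3} (hΓ : IsContactVariation M c J a b ε Γ) {t : ℝ}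
    (ht : t ∈ J \ Ioo a b) : variationField Γ t = 0 := by
  have hzero : ∀ τ ∈ J \ Icc a b, variationField Γ τ = 0 := by
    intro τ hτ
    have h1 := ((hΓ.smooth.contDiffAt ((isOpen_Ioo.prod hJ).mem_nhds
      (mk_mem_prod (⟨by linarith, hε⟩ : (0 : ℝ) ∈ Ioo (-ε) ε) hτ.1))).differentiableAt
      (by simp)).hasFDerivAt
    have h2 : HasDerivAt (fun s : ℝ => (s, τ)) ((1 : ℝ), (0 : ℝ)) 0 :=
      (hasDerivAt_id (0 : ℝ)).prodMk (hasDerivAt_const (0 : ℝ) τ)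
    have h3 := h1.comp_hasDerivAt (0 : ℝ) h2
    have h4 : HasDerivAt (Γ ∘ fun s : ℝ => (s, τ)) 0 0 := by
      refine (hasDerivAt_const (0 : ℝ) (c τ)).congr_of_eventuallyEq ?_
      filter_upwards [isOpen_Ioo.mem_nhds (⟨by linarith, hε⟩ : (0 : ℝ) ∈ Ioo (-ε) ε)] with s hs
      exact hΓ.support s hs τ hτ
    exact h3.unique h4
  have hcont : ContinuousAt (variationField Γ) t :=
    ((contDiffOn_variationField hJ hε hΓ).contDiffAt (hJ.mem_nhds ht.1)).continuousAt
  have hfreq : ∃ᶠ τ in 𝓝 t, variationField Γ τ = 0 := by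
    have hJt := hJ.mem_nhds ht.1
    rcases lt_trichotomy t a with h | h | h
    · exact fun h' => h'.self_of_nhds (hzero t ⟨ht.1, fun h' => absurd h'.1 (not_le.2 h)⟩)
    · have h1 : ∃ᶠ τ in 𝓝 t, τ < t := frequently_lt_nhds t
      exact (h1.and_eventually hJt).mono fun τ hτ =>
        hzero τ ⟨hτ.2, fun h' => by linarith [h'.1, hτ.1]⟩
    · have hbt : b ≤ t := by
        by_contra hlt
        exact ht.2 ⟨h, not_le.1 hlt⟩
      have h1 : ∃ᶠ τ in 𝓝 t, t < τ := frequently_gt_nhds t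
      exact (h1.and_eventually hJt).mono fun τ hτ =>
        hzero τ ⟨hτ.2, fun h' => by linarith [h'.2, hτ.1]⟩
  by_contra hne
  exact hfreq (hcont.eventually_ne hne)

/-- The quotient of a smooth function by another one that does not vanish on its support is
smooth. -/
theorem contDiffOn_div_of_tsupport {J : Set ℝ} (hJ : IsOpen J) {u v : ℝ → ℝ}
    (hu : ContDiff ℝ ∞ u) (hv : ContDiffOn ℝ ∞ v J) (h : ∀ t ∈ J, t ∈ tsupport u → v t ≠ 0) :
    ContDiffOn ℝ ∞ (fun t => u t / v t) J := by
  intro t ht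
  by_cases hts : t ∈ tsupport u
  · exact (hu.contDiffAt.div (hv.contDiffAt (hJ.mem_nhds ht)) (h t ht hts)).contDiffWithinAt
  · have h0 : u =ᶠ[𝓝 t] 0 := notMem_tsupport_iff_eventuallyEq.1 hts
    have : (fun t => u t / v t) =ᶠ[𝓝 t] fun _ => 0 := by
      filter_upwards [h0] with τ hτ
      simp [hτ]
    exact (contDiffAt_const.congr_of_eventuallyEq this).contDiffWithinAt

/-- Straight-line variations along a compactly supported field. -/
theorem exists_contactVariation_of_field {c W : ℝ → Vec 3} {J : Set ℝ} (hJ : IsOpen J)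
    (hM : IsOpen M) (hc : ContDiffOn ℝ ∞ c J) (hcM : ∀ t ∈ J, c t ∈ M)
    (hW : ContDiffOn ℝ ∞ W J) {a b : ℝ} (hab : Icc a b ⊆ J)
    (hsupp : ∀ t ∈ J \ Icc a b, W t = 0)
    (hcontact : ∀ s : ℝ, ∀ t ∈ J, contactForm (c t + s • W t) (deriv c t + s • deriv W t) = 0) :
    ∃ ε > 0, ∃ Γ : ℝ × ℝ → Vec 3, IsContactVariation M c J a b ε Γ ∧
      ∀ t ∈ J, variationField Γ t = W t := by
  have hK : IsCompact (c '' Icc a b) :=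
    isCompact_Icc.image_of_continuousOn (hc.continuousOn.mono hab)
  obtain ⟨δ, hδ, hδM⟩ := hK.exists_thickening_subset_open hM
    (by rintro _ ⟨t, ht, rfl⟩; exact hcM t (hab ht))
  obtain ⟨B, hB⟩ := (isCompact_Icc (a := a) (b := b)).exists_bound_of_continuousOn
    (hW.continuousOn.mono hab)
  have hB1 : 0 < |B| + 1 := by positivity
  refine ⟨δ / (|B| + 1), div_pos hδ hB1, fun x => c x.2 + x.1 • W x.2, ⟨?_, ?_, ?_, ?_, ?_⟩, ?_⟩
  · have h2 : MapsTo (Prod.snd : ℝ × ℝ → ℝ) (Ioo (-(δ / (|B| + 1))) (δ / (|B| + 1)) ×ˢ J) J :=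
      fun x hx => hx.2
    exact (hc.comp contDiffOn_snd h2).add (contDiffOn_fst.smul (hW.comp contDiffOn_snd h2))
  · intro t _; simp
  · intro s _ t ht; simp [hsupp t ht]
  · intro s hs t ht
    by_cases htI : t ∈ Icc a b
    · apply hδM
      rw [Metric.mem_thickening_iff]
      refine ⟨c t, ⟨t, htI, rfl⟩, ?_⟩
      rw [dist_eq_norm, add_sub_cancel_left, norm_smul, Real.norm_eq_abs]
      have h1 : |s| < δ / (|B| + 1) := abs_lt.2 hs
      have h2 : ‖W t‖ ≤ |B| + 1 := (hB t htI).trans ((le_abs_self B).trans (by linarith))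
      calc |s| * ‖W t‖ ≤ |s| * (|B| + 1) := by gcongr
        _ < δ / (|B| + 1) * (|B| + 1) := by gcongr
        _ = δ := div_mul_cancel₀ _ hB1.ne'
    · simp [hsupp t ⟨ht, htI⟩, hcM t ht]
  · intro s _ t ht
    have h1 : HasDerivAt c (deriv c t) t :=
      ((hc.contDiffAt (hJ.mem_nhds ht)).differentiableAt (by simp)).hasDerivAt
    have h2 : HasDerivAt W (deriv W t) t :=
      ((hW.contDiffAt (hJ.mem_nhds ht)).differentiableAt (by simp)).hasDerivAt
    rw [(h1.fun_add (h2.fun_const_smul s)).deriv]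
    exact hcontact s t ht
  · intro t ht
    have h1 : HasFDerivAt (fun x : ℝ × ℝ => c x.2) _ ((0 : ℝ), t) :=
      ((hc.contDiffAt (hJ.mem_nhds ht)).differentiableAt (by simp)).hasFDerivAt.comp
        ((0 : ℝ), t) hasFDerivAt_snd
    have h2 : HasFDerivAt (fun x : ℝ × ℝ => W x.2) _ ((0 : ℝ), t) :=
      ((hW.contDiffAt (hJ.mem_nhds ht)).differentiableAt (by simp)).hasFDerivAt.comp
        ((0 : ℝ), t) hasFDerivAt_snd
    have h3 := h1.fun_add ((hasFDerivAt_fst (𝕜 := ℝ) (p := ((0 : ℝ), t))).fun_smul h2)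
    rw [variationField, h3.fderiv]
    simp

/-- Near a parameter value of a regular contact curve there are contact variations whose
variational fields have a non-negative, non-zero contact component. -/
theorem exists_contactVariation {c : ℝ → Vec 3} {J : Set ℝ} (hJ : IsOpen J) (hM : IsOpen M)
    (hc : ContDiffOn ℝ ∞ c J) (hcM : ∀ t ∈ J, c t ∈ M)
    (hcon : ∀ t ∈ J, contactForm (c t) (deriv c t) = 0) {t₀ : ℝ} (ht₀ : t₀ ∈ J)
    (hreg : deriv c t₀ ≠ 0) {N : Set ℝ} (hN : N ∈ 𝓝 t₀) :
    ∃ (f : ℝ → ℝ) (a b ε : ℝ) (Γ : ℝ × ℝ → Vec 3), Continuous f ∧ (∀ t, 0 ≤ f t) ∧ 0 < f t₀ ∧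
      t₀ ∈ Ioo a b ∧ Icc a b ⊆ J ∩ N ∧ 0 < ε ∧ IsContactVariation M c J a b ε Γ ∧
      ∀ t ∈ J, contactForm (c t) (variationField Γ t) = f t := by
  have hdc : ContDiffOn ℝ ∞ (deriv c) J := hc.deriv_of_isOpen hJ (by simp)
  have hci : ∀ i : Fin 3, ContDiffOn ℝ ∞ (fun t => c t i) J := fun i => contDiffOn_pi.1 hc i
  have hdci : ∀ i : Fin 3, ContDiffOn ℝ ∞ (fun t => deriv c t i) J := fun i =>
    contDiffOn_pi.1 hdc i
  have hderi : ∀ (i : Fin 3), ∀ t ∈ J, HasDerivAt (fun t => c t i) (deriv c t i) t :=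
    fun i t ht => hasDerivAt_pi.1
      ((hc.contDiffAt (hJ.mem_nhds ht)).differentiableAt (by simp)).hasDerivAt i
  -- an interval around `t₀` on which a given component of the velocity does not vanish, with a bump
  have bump : ∀ i : Fin 3, deriv c t₀ i ≠ 0 → ∃ (f : ℝ → ℝ) (a b : ℝ), ContDiff ℝ ∞ f ∧
      (∀ t, 0 ≤ f t) ∧ 0 < f t₀ ∧ t₀ ∈ Ioo a b ∧ Icc a b ⊆ J ∩ N ∧ tsupport f ⊆ Icc a b ∧
      ∀ t ∈ Icc a b, deriv c t i ≠ 0 := by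
    intro i hi
    have hev : ∀ᶠ t in 𝓝 t₀, t ∈ J ∩ N ∧ deriv c t i ≠ 0 :=
      (Filter.eventually_mem_set.2 (inter_mem (hJ.mem_nhds ht₀) hN)).and
        (((hdci i).contDiffAt (hJ.mem_nhds ht₀)).continuousAt.eventually_ne hi)
    obtain ⟨δ, hδ, hball⟩ := Metric.nhds_basis_closedBall.eventually_iff.1 hev
    rw [Real.closedBall_eq_Icc] at hball
    obtain ⟨f, hf1, hf2, hf3, hf4, hf5⟩ := exists_contDiff_tsupport_subset (n := ⊤)
      (Icc_mem_nhds (show t₀ - δ < t₀ by linarith) (show t₀ < t₀ + δ by linarith))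
    refine ⟨f, t₀ - δ, t₀ + δ, hf3, fun t => (hf4 (mem_range_self t)).1, by rw [hf5]; norm_num,
      ⟨by linarith, by linarith⟩, fun t ht => (hball ht).1, hf1, fun t ht => (hball ht).2⟩
  have hy : ∀ t ∈ J, deriv c t 1 = c t 2 * deriv c t 0 := by
    intro t ht
    have := hcon t ht
    rw [contactForm_apply] at this
    linarith
  by_cases hx : deriv c t₀ 0 ≠ 0
  · obtain ⟨f, a, b, hf, hf0, hft, htab, hab, hsupp, hne⟩ := bump 0 hx
    have hdf : ContDiff ℝ ∞ (deriv f) := (contDiff_infty_iff_deriv.1 hf).2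
    have hfd : ∀ t, HasDerivAt f (deriv f t) t := fun t =>
      (hf.differentiable (by simp) t).hasDerivAt
    have hts : ∀ t, t ∈ tsupport (deriv f) → t ∈ Icc a b := fun t ht =>
      hsupp (tsupport_deriv_subset ht)
    have hr : ContDiffOn ℝ ∞ (fun t => deriv f t / deriv c t 0) J :=
      contDiffOn_div_of_tsupport hJ hdf (hdci 0) fun t _ ht => hne t (hts t ht)
    have hzero : ∀ t, t ∉ Icc a b → f t = 0 ∧ deriv f t = 0 := fun t ht =>
      ⟨image_eq_zero_of_notMem_tsupport fun h => ht (hsupp h),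
        image_eq_zero_of_notMem_tsupport fun h => ht (hts t h)⟩
    have hrm : ∀ t, deriv f t / deriv c t 0 * deriv c t 0 = deriv f t := by
      intro t
      by_cases ht : t ∈ Icc a b
      · exact div_mul_cancel₀ _ (hne t ht)
      · simp [(hzero t ht).2]
    -- The contact component is prescribed as `f` and `x` is kept fixed. The linearized contact
    -- condition `f' = r x'` determines the `z`-component `r`. No term quadratic in `s` arises, so
    -- straight lines along the field stay contact.
    have hWc : ContDiffOn ℝ ∞ (fun t => (![0, f t, deriv f t / deriv c t 0] : Vec 3)) J := by
      refine contDiffOn_pi.2 fun i => ?_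
      fin_cases i
      exacts [contDiffOn_const, hf.contDiffOn, hr]
    obtain ⟨ε, hε, Γ, hΓ, hΓV⟩ := exists_contactVariation_of_field hJ hM hc hcM hWc
      (hab.trans inter_subset_left) (fun t ht => by simp [hzero t ht.2]) (fun s t ht => by
        have hW : HasDerivAt (fun t => (![0, f t, deriv f t / deriv c t 0] : Vec 3))
            ![0, deriv f t, deriv (fun t => deriv f t / deriv c t 0) t] t := by
          refine hasDerivAt_pi.2 fun i => ?_
          fin_cases i
          exacts [hasDerivAt_const _ _, hfd t,
            ((hr.contDiffAt (hJ.mem_nhds ht)).differentiableAt (by simp)).hasDerivAt]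
        rw [hW.deriv, contactForm_apply]
        simp [hy t ht]
        linear_combination (-s) * hrm t)
    refine ⟨f, a, b, ε, Γ, hf.continuous, hf0, hft, htab, hab, hε, hΓ, fun t ht => ?_⟩
    rw [hΓV t ht, contactForm_apply]
    simp
  · have hx : deriv c t₀ 0 = 0 := not_not.1 hx
    have hz : deriv c t₀ 2 ≠ 0 := by
      intro hz
      apply hreg
      ext i
      fin_cases i
      exacts [hx, by simp [hy t₀ ht₀, hx], hz]
    obtain ⟨f, a, b, hf, hf0, hft, htab, hab, hsupp, hne⟩ := bump 2 hz
    have hdf : ContDiff ℝ ∞ (deriv f) := (contDiff_infty_iff_deriv.1 hf).2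
    have hfd : ∀ t, HasDerivAt f (deriv f t) t := fun t =>
      (hf.differentiable (by simp) t).hasDerivAt
    have hts : ∀ t, t ∈ tsupport (deriv f) → t ∈ Icc a b := fun t ht =>
      hsupp (tsupport_deriv_subset ht)
    have hr : ContDiffOn ℝ ∞ (fun t => deriv f t / deriv c t 2) J :=
      contDiffOn_div_of_tsupport hJ hdf (hdci 2) fun t _ ht => hne t (hts t ht)
    have hzero : ∀ t, t ∉ Icc a b → f t = 0 ∧ deriv f t = 0 := fun t ht =>
      ⟨image_eq_zero_of_notMem_tsupport fun h => ht (hsupp h),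
        image_eq_zero_of_notMem_tsupport fun h => ht (hts t h)⟩
    have hrm : ∀ t, deriv f t / deriv c t 2 * deriv c t 2 = deriv f t := by
      intro t
      by_cases ht : t ∈ Icc a b
      · exact div_mul_cancel₀ _ (hne t ht)
      · simp [(hzero t ht).2]
    -- Where `x'` vanishes, `z'` does not, and `z` is kept fixed instead. With `r = f' / z'`, the
    -- components `-r` and `f - z r` have contact component `f` and satisfy the contact condition
    -- exactly.
    have hWc : ContDiffOn ℝ ∞ (fun t => (![-(deriv f t / deriv c t 2),
        f t - c t 2 * (deriv f t / deriv c t 2), 0] : Vec 3)) J := by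
      refine contDiffOn_pi.2 fun i => ?_
      fin_cases i
      exacts [hr.neg, hf.contDiffOn.sub ((hci 2).mul hr), contDiffOn_const]
    obtain ⟨ε, hε, Γ, hΓ, hΓV⟩ := exists_contactVariation_of_field hJ hM hc hcM hWc
      (hab.trans inter_subset_left) (fun t ht => by simp [hzero t ht.2]) (fun s t ht => by
        have hrd := ((hr.contDiffAt (hJ.mem_nhds ht)).differentiableAt (by simp)).hasDerivAt
        have hW : HasDerivAt (fun t => (![-(deriv f t / deriv c t 2),
            f t - c t 2 * (deriv f t / deriv c t 2), 0] : Vec 3))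
            ![-deriv (fun t => deriv f t / deriv c t 2) t,
              deriv f t - (deriv c t 2 * (deriv f t / deriv c t 2)
                + c t 2 * deriv (fun t => deriv f t / deriv c t 2) t), 0] t := by
          refine hasDerivAt_pi.2 fun i => ?_
          fin_cases i
          exacts [hrd.fun_neg, (hfd t).fun_sub ((hderi 2 t ht).fun_mul hrd), hasDerivAt_const _ _]
        rw [hW.deriv, contactForm_apply]
        simp [hy t ht]
        linear_combination (-s) * hrm t)
    refine ⟨f, a, b, ε, Γ, hf.continuous, hf0, hft, htab, hab, hε, hΓ, fun t ht => ?_⟩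
    rw [hΓV t ht, contactForm_apply]
    simp

end Variation

/-! ### The first variation formula and its vanishing -/

section Geodesics

variable {P : Set (Vec 5)} {M : Set (Vec 3)} {ρ : Vec 5 → Vec 3}
  {L : Vec 5 → Submodule ℝ (Vec 5)} {η : Coframe} {C : ConnectionData}

/-- The sign of `x` is locally constant, so it differentiates as a constant factor. No orientation
of the paths by `σ` is needed. -/
theorem hasDerivAt_sign_mul {x B : ℝ → ℝ} {t : ℝ} (hx : ContinuousAt x t) (hxt : x t ≠ 0)
    (hB : DifferentiableAt ℝ B t) :
    HasDerivAt (fun τ => x τ / |x τ| * B τ) (x t / |x t| * deriv B t) t := by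
  have hev : (fun τ => x τ / |x τ| * B τ) =ᶠ[𝓝 t] fun τ => x t / |x t| * B τ := by
    rcases lt_or_gt_of_ne hxt with h | h
    · filter_upwards [hx.eventually_lt_const h] with τ hτ
      rw [abs_of_neg hτ, abs_of_neg h, div_neg, div_neg, div_self hτ.ne, div_self h.ne]
    · filter_upwards [hx.eventually_const_lt h] with τ hτ
      rw [abs_of_pos hτ, abs_of_pos h, div_self hτ.ne', div_self h.ne']
  exact (hB.hasDerivAt.const_mul _).congr_of_eventuallyEq hev

/-- The first variation of the length of a projected path. -/
theorem hasDerivAt_length (hP : IsContactPathGeometry P M ρ L) (hη : η.IsAdapted P ρ L)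
    (hC : η.StructureEquations C P) (hvar : C.IsVariational P) (hcan : C.IsCanonical P)
    {W₀ W₁ W₂ : Vec 5 → ℝ} (hW : η.IsExpansionW C P W₀ W₁ W₂)
    {H G₀ G₁ G₂ G₃ : Vec 5 → ℝ} (hG : η.IsExpansionG C P H G₀ G₁ G₂ G₃)
    (hW₂ : ∀ p ∈ P, W₂ p = 0) {g : SubRiemannianMetric M} (hg : g.IsDefinedBy η P ρ)
    {h : Vec 5 → ℝ} (hhs : ContDiffOn ℝ ∞ h P)
    (hh : ∀ p ∈ P, ∀ v, η.θ₀ p v = h p * contactForm (ρ p) (fderiv ℝ ρ p v))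
    {γ : ℝ → Vec 5} {J : Set ℝ} (hJ : IsOpen J) (hγ : IsPath P L γ J) {a b ε : ℝ} (hε : 0 < ε)
    (hab : a < b) (habJ : Icc a b ⊆ J)
    {Γ : ℝ × ℝ → Vec 3} (hΓ : IsContactVariation M (ρ ∘ γ) J a b ε Γ) :
    HasDerivAt (fun s => g.length (fun t => Γ (s, t)) a b)
      (∫ t in a..b, 2 * |η.σ (γ t) (deriv γ t)| * (G₁ (γ t) - 2 * W₀ (γ t))
        * (h (γ t) * contactForm (ρ (γ t)) (variationField Γ t))) 0 := by
  obtain ⟨sσ, s0, s1, s2, s3⟩ := hη.smooth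
  obtain ⟨hW0, hW1⟩ := hW.contDiffOn hP.isOpen_P hη hC hvar hcan
  have hG1 := hG.contDiffOn hP.isOpen_P hη hC
  have hω : ContDiffOn ℝ ∞ (η.lengthForm W₁) P :=
    sσ.add ((contDiffOn_const.mul hW1).smul s0)
  obtain ⟨s, hs, hsf⟩ := exists_factor hP.isOpen_P hP.smooth hP.submersion hω
    fun p hp v hv => by
      simp [Coframe.lengthForm, hC.σ_vertical hP hη hp hv, hη.θ₀_vertical hp hv]
  have h0ε : (0 : ℝ) ∈ Ioo (-ε) ε := ⟨by linarith, hε⟩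
  set U : Set (ℝ × ℝ) := Ioo (-ε) ε ×ˢ J with hUdef
  have hU : IsOpen U := isOpen_Ioo.prod hJ
  -- the squared line element
  set Q : ℝ × ℝ → ℝ := fun x => g.sq (Γ x) (fderiv ℝ Γ x (0, 1)) with hQ
  have hΓM : MapsTo Γ U M := fun x hx => hΓ.mem x.1 hx.1 x.2 hx.2
  have hdΓ : ContDiffOn ℝ ∞ (fun x => fderiv ℝ Γ x (0, 1)) U :=
    (hΓ.smooth.fderiv_of_isOpen hU (by simp)).clm_apply contDiffOn_const
  have hdΓi : ∀ i : Fin 3, ContDiffOn ℝ ∞ (fun x => fderiv ℝ Γ x (0, 1) i) U := fun i =>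
    contDiffOn_pi.1 hdΓ i
  have hQs : ContDiffOn ℝ ∞ Q U :=
    (((g.smooth_E.comp hΓ.smooth hΓM).mul ((hdΓi 0).pow 2)).add
      (((g.smooth_F.comp hΓ.smooth hΓM).mul (hdΓi 0)).mul (hdΓi 2))).add
      ((g.smooth_G.comp hΓ.smooth hΓM).mul ((hdΓi 2).pow 2))
  have hσ0 : ∀ t ∈ J, η.σ (γ t) (deriv γ t) ≠ 0 := fun t ht =>
    hη.σ_ne_zero (hγ.mem t ht) (hγ.tangent t ht) (hγ.regular t ht)
  have hQ0 : ∀ t ∈ J, 0 < Q (0, t) := by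
    intro t ht
    have hp := hγ.mem t ht
    have h1 : deriv (fun τ => Γ (0, τ)) t = fderiv ℝ ρ (γ t) (deriv γ t) := by
      have h2 : (fun τ => Γ (0, τ)) =ᶠ[𝓝 t] ρ ∘ γ := by
        filter_upwards [hJ.mem_nhds ht] with τ hτ using hΓ.zero τ hτ
      rw [h2.deriv_eq]
      exact ((differentiableAt_of_isOpen hP.isOpen_P hP.smooth hp).hasFDerivAt.comp_hasDerivAt t
        ((hγ.smooth.contDiffAt (hJ.mem_nhds ht)).differentiableAt (by simp)).hasDerivAt).deriv
    simp only [hQ]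
    rw [← hΓ.deriv_eq hJ h0ε ht, h1, hΓ.zero t ht, Function.comp_apply,
      hg _ hp _ (hP.contact _ hp _ (hγ.tangent t ht))]
    have := hσ0 t ht
    positivity
  -- The square root is smooth only where the squared line element is positive. This holds on a
  -- neighbourhood of the central curve.
  set U' : Set (ℝ × ℝ) := U ∩ Q ⁻¹' Ioi 0 with hU'def
  have hU' : IsOpen U' := hQs.continuousOn.isOpen_inter_preimage hU isOpen_Ioi
  have hf : ContDiffOn ℝ 1 (fun x => √(Q x)) U' :=
    ((hQs.of_le (by simp)).mono inter_subset_left).sqrt fun x hx => (mem_Ioi.1 hx.2).ne'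
  have hmain := hasDerivAt_integral_of_contDiffOn hU' hf hab.le
    fun t ht => ⟨⟨h0ε, habJ ht⟩, hQ0 t (habJ ht)⟩
  have hlen : (fun s => g.length (fun t => Γ (s, t)) a b) =ᶠ[𝓝 0]
      fun s => ∫ t in a..b, √(Q (s, t)) := by
    filter_upwards [isOpen_Ioo.mem_nhds h0ε] with s hs
    refine intervalIntegral.integral_congr fun t ht => ?_
    rw [uIcc_of_le hab.le] at ht
    simp only [hQ]
    rw [hΓ.deriv_eq hJ hs (habJ ht)]
  refine (hmain.congr_of_eventuallyEq hlen).congr_deriv ?_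
  -- integration by parts
  have hV := contDiffOn_variationField hJ hε hΓ
  have hγP : MapsTo γ J P := hγ.mem
  have hcomp : ∀ {G : Type} [NormedAddCommGroup G] [NormedSpace ℝ G] {φ : Vec 5 → G},
      ContDiffOn ℝ ∞ φ P → ContDiffOn ℝ ∞ (fun t => φ (γ t)) J := fun hφ =>
    hφ.comp hγ.smooth hγP
  have hdγ : ContDiffOn ℝ ∞ (deriv γ) J := hγ.smooth.deriv_of_isOpen hJ (by simp)
  have hx : ContinuousOn (fun t => η.σ (γ t) (deriv γ t)) J :=
    ((hcomp sσ).clm_apply hdγ).continuousOn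
  have hB : ContDiffOn ℝ ∞ (fun t => s (γ t) (variationField Γ t)) J := (hcomp hs).clm_apply hV
  set D : ℝ → ℝ := fun t => fderiv ℝ (fun x => √(Q x)) (0, t) (1, 0) with hD
  set K : ℝ → ℝ := fun t => 2 * |η.σ (γ t) (deriv γ t)| * (G₁ (γ t) - 2 * W₀ (γ t))
    * (h (γ t) * contactForm (ρ (γ t)) (variationField Γ t)) with hK
  have hDc : ContinuousOn D (Icc a b) :=
    ((hf.continuousOn_fderiv_of_isOpen hU' le_rfl).clm_apply continuousOn_const).comp
      (f := fun t : ℝ => ((0 : ℝ), t)) (by fun_prop)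
      fun t ht => ⟨⟨h0ε, habJ ht⟩, hQ0 t (habJ ht)⟩
  have hρi : ∀ i : Fin 3, ContinuousOn (fun t => ρ (γ t) i) J := fun i =>
    (contDiffOn_pi.1 (hcomp hP.smooth) i).continuousOn
  have hVi : ∀ i : Fin 3, ContinuousOn (fun t => variationField Γ t i) J := fun i =>
    (contDiffOn_pi.1 hV i).continuousOn
  have hKc : ContinuousOn K (Icc a b) := by
    refine ContinuousOn.mono ?_ habJ
    simp only [hK, contactForm_apply]
    exact ((continuousOn_const.mul hx.abs).mul ((hcomp hG1).continuousOn.sub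
      (continuousOn_const.mul (hcomp hW0).continuousOn))).mul
      ((hcomp hhs).continuousOn.mul ((hVi 1).sub ((hρi 2).mul (hVi 0))))
  have hDK : ∀ t ∈ J, D t - K t =
      η.σ (γ t) (deriv γ t) / |η.σ (γ t) (deriv γ t)|
        * deriv (fun τ => s (γ τ) (variationField Γ τ)) t := by
    intro t ht
    have h1 := fderiv_lineElement hP hη hC hvar hcan hW hG hW₂ hg hh hsf hJ hγ hε hΓ ht
    simp only [hD, hQ, hK]
    rw [h1]
    have h2 : |η.σ (γ t) (deriv γ t)| ≠ 0 := abs_ne_zero.2 (hσ0 t ht)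
    have h3 := sq_abs (η.σ (γ t) (deriv γ t))
    field_simp
    rw [h3]
    ring
  -- The difference is the derivative of the signed value of the length form on the variation field,
  -- and that field vanishes at `a` and `b`.
  have hFTC : ∫ t in a..b, (D t - K t) = 0 := by
    have h1 := intervalIntegral.integral_eq_sub_of_hasDerivAt (a := a) (b := b)
      (f := fun t => η.σ (γ t) (deriv γ t) / |η.σ (γ t) (deriv γ t)|
        * s (γ t) (variationField Γ t)) (f' := fun t => D t - K t)
      (fun t ht => by
        rw [uIcc_of_le hab.le] at ht
        have htJ := habJ ht
        rw [hDK t htJ]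
        exact hasDerivAt_sign_mul (hx.continuousAt (hJ.mem_nhds htJ)) (hσ0 t htJ)
          ((hB.contDiffAt (hJ.mem_nhds htJ)).differentiableAt (by simp)))
      (ContinuousOn.intervalIntegrable (by rw [uIcc_of_le hab.le]; exact hDc.sub hKc))
    rw [h1, variationField_eq_zero hJ hε hΓ ⟨habJ ⟨le_rfl, hab.le⟩, fun h' => lt_irrefl _ h'.1⟩,
      variationField_eq_zero hJ hε hΓ ⟨habJ ⟨hab.le, le_rfl⟩, fun h' => lt_irrefl _ h'.2⟩]
    simp
  rw [intervalIntegral.integral_sub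
    (ContinuousOn.intervalIntegrable (by rw [uIcc_of_le hab.le]; exact hDc))
    (ContinuousOn.intervalIntegrable (by rw [uIcc_of_le hab.le]; exact hKc))] at hFTC
  linarith

theorem IsPath.projection (hP : IsContactPathGeometry P M ρ L) {γ : ℝ → Vec 5} {J : Set ℝ}
    (hJ : IsOpen J) (hγ : IsPath P L γ J) :
    ContDiffOn ℝ ∞ (ρ ∘ γ) J ∧ (∀ t ∈ J, (ρ ∘ γ) t ∈ M) ∧ (∀ t ∈ J, deriv (ρ ∘ γ) t ≠ 0) ∧
      ∀ t ∈ J, contactForm ((ρ ∘ γ) t) (deriv (ρ ∘ γ) t) = 0 := by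
  have hd : ∀ t ∈ J, deriv (ρ ∘ γ) t = fderiv ℝ ρ (γ t) (deriv γ t) := fun t ht =>
    ((differentiableAt_of_isOpen hP.isOpen_P hP.smooth (hγ.mem t ht)).hasFDerivAt.comp_hasDerivAt t
      ((hγ.smooth.contDiffAt (hJ.mem_nhds ht)).differentiableAt (by simp)).hasDerivAt).deriv
  refine ⟨hP.smooth.comp hγ.smooth hγ.mem, fun t ht => hP.mapsTo (hγ.mem t ht), fun t ht h0 => ?_,
    fun t ht => ?_⟩
  · rw [hd t ht] at h0
    exact hγ.regular t ht
      (Submodule.disjoint_def.1 (hP.transverse _ (hγ.mem t ht)) _ (hγ.tangent t ht) h0)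
  · rw [hd t ht]
    exact hP.contact _ (hγ.mem t ht) _ (hγ.tangent t ht)

theorem exists_path (hP : IsContactPathGeometry P M ρ L) {p : Vec 5} (hp : p ∈ P) :
    ∃ (γ : ℝ → Vec 5) (ε : ℝ), 0 < ε ∧ γ 0 = p ∧ IsPath P L γ (Ioo (-ε) ε) := by
  obtain ⟨X, hX⟩ := hP.lineField p hp
  obtain ⟨γ, ε, hε, h0, hγ, hγX⟩ := exists_contDiffOn_integralCurve (hX.mono fun q hq => hq.1)
    (S := {q | q ∈ P ∧ X q ≠ 0 ∧ L q = Submodule.span ℝ {X q}})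
    ((Filter.eventually_mem_set.2 (hP.isOpen_P.mem_nhds hp)).and (hX.mono fun q hq => hq.2))
  refine ⟨γ, ε, hε, h0, hγ, fun t ht => (hγX t ht).1.1, fun t ht => ?_, fun t ht => ?_⟩
  · rw [(hγX t ht).2.deriv]; exact (hγX t ht).1.2.1
  · rw [(hγX t ht).2.deriv, (hγX t ht).1.2.2]; exact Submodule.mem_span_singleton_self _

/-- The first variation is the integral of the contact component of the field against a multiple of
`G₁ - 2 W₀` that vanishes only where `G₁ - 2 W₀` does. The fundamental lemma of the calculus of
variations applies along each path. -/
theorem pathsAreGeodesics_iff (hP : IsContactPathGeometry P M ρ L) (hη : η.IsAdapted P ρ L)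
    (hC : η.StructureEquations C P) (hvar : C.IsVariational P) (hcan : C.IsCanonical P)
    {W₀ W₁ W₂ : Vec 5 → ℝ} (hW : η.IsExpansionW C P W₀ W₁ W₂)
    {H G₀ G₁ G₂ G₃ : Vec 5 → ℝ} (hG : η.IsExpansionG C P H G₀ G₁ G₂ G₃)
    (hW₂ : ∀ p ∈ P, W₂ p = 0) {g : SubRiemannianMetric M} (hg : g.IsDefinedBy η P ρ) :
    PathsAreGeodesics P ρ L g ↔ ∀ p ∈ P, G₁ p = 2 * W₀ p := by
  obtain ⟨h, hhs, hh0, hh⟩ := exists_factor_θ₀ hP hη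
  constructor
  · intro hgeo p hp
    by_contra hne
    obtain ⟨γ, δ, hδ, hγ0, hγ⟩ := exists_path hP hp
    have h0J : (0 : ℝ) ∈ Ioo (-δ) δ := ⟨by linarith, hδ⟩
    obtain ⟨hc, hcM, hcr, hcc⟩ := hγ.projection hP isOpen_Ioo
    obtain ⟨hW0, -⟩ := hW.contDiffOn hP.isOpen_P hη hC hvar hcan
    have hG1 := hG.contDiffOn hP.isOpen_P hη hC
    have hcomp : ∀ {G : Type} [NormedAddCommGroup G] [NormedSpace ℝ G] {φ : Vec 5 → G},
        ContDiffOn ℝ ∞ φ P → ContDiffOn ℝ ∞ (fun t => φ (γ t)) (Ioo (-δ) δ) := fun hφ =>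
      hφ.comp hγ.smooth hγ.mem
    set m : ℝ → ℝ := fun t => 2 * |η.σ (γ t) (deriv γ t)| * (G₁ (γ t) - 2 * W₀ (γ t)) * h (γ t)
      with hm
    have hdγ : ContDiffOn ℝ ∞ (deriv γ) (Ioo (-δ) δ) :=
      hγ.smooth.deriv_of_isOpen isOpen_Ioo (by simp)
    have hmc : ContinuousOn m (Ioo (-δ) δ) :=
      ((continuousOn_const.mul ((hcomp hη.smooth.1).clm_apply hdγ).continuousOn.abs).mul
        ((hcomp hG1).continuousOn.sub (continuousOn_const.mul (hcomp hW0).continuousOn))).mul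
        (hcomp hhs).continuousOn
    have hm0 : m 0 ≠ 0 := by
      have h1 : η.σ (γ 0) (deriv γ 0) ≠ 0 :=
        hη.σ_ne_zero (hγ.mem 0 h0J) (hγ.tangent 0 h0J) (hγ.regular 0 h0J)
      have h2 : G₁ (γ 0) - 2 * W₀ (γ 0) ≠ 0 := by rw [hγ0]; exact sub_ne_zero.2 hne
      exact mul_ne_zero (mul_ne_zero (mul_ne_zero two_ne_zero (abs_ne_zero.2 h1)) h2)
        (hh0 _ (hγ.mem 0 h0J))
    -- The variation is supported where `m` keeps the sign of `m 0`. Multiplying by `m 0` makes the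
    -- integrand non-negative and positive at `0`, whichever sign `m 0` has.
    have hN : {t | 0 < m 0 * m t} ∈ 𝓝 (0 : ℝ) := by
      have h1 : ContinuousAt (fun t => m 0 * m t) 0 :=
        continuousAt_const.mul (hmc.continuousAt (isOpen_Ioo.mem_nhds h0J))
      exact h1.eventually_const_lt (mul_self_pos.2 hm0)
    obtain ⟨f, a, b, ε, Γ, hf, hf0, hft, htab, habJ, hε, hΓ, hΓf⟩ :=
      exists_contactVariation isOpen_Ioo hP.isOpen_M hc hcM hcc h0J (hcr 0 h0J) hN
    have hab : a < b := htab.1.trans htab.2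
    have hext := (hgeo γ _ isOpen_Ioo ordConnected_Ioo hγ).extremal a b ε hab
      (habJ.trans inter_subset_left) hε Γ hΓ
    have hlen := hasDerivAt_length hP hη hC hvar hcan hW hG hW₂ hg hhs hh isOpen_Ioo hγ hε hab
      (habJ.trans inter_subset_left) hΓ
    have hz := hlen.unique hext
    have hpos : 0 < ∫ t in a..b, m 0 * m t * f t := by
      refine intervalIntegral.integral_pos hab
        ((continuousOn_const.mul (hmc.mono (habJ.trans inter_subset_left))).mul hf.continuousOn)
        (fun t ht => ?_) ⟨0, ⟨htab.1.le, htab.2.le⟩, ?_⟩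
      · exact mul_nonneg (le_of_lt (habJ (Ioc_subset_Icc_self ht)).2) (hf0 t)
      · exact mul_pos (mul_self_pos.2 hm0) hft
    have heq : ∫ t in a..b, m 0 * m t * f t =
        m 0 * ∫ t in a..b, 2 * |η.σ (γ t) (deriv γ t)| * (G₁ (γ t) - 2 * W₀ (γ t))
        * (h (γ t) * contactForm (ρ (γ t)) (variationField Γ t)) := by
      rw [← intervalIntegral.integral_const_mul]
      refine intervalIntegral.integral_congr fun t ht => ?_
      rw [uIcc_of_le hab.le] at ht
      have := hΓf t (habJ ht).1
      simp only [Function.comp_apply] at this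
      simp only [this, hm]
      ring
    rw [heq, hz, mul_zero] at hpos
    exact lt_irrefl _ hpos
  · intro hGW γ J hJ _ hγ
    obtain ⟨hc, hcM, hcr, hcc⟩ := hγ.projection hP hJ
    refine ⟨hc, hcM, hcr, hcc, fun a b ε hab habJ hε Γ hΓ => ?_⟩
    have hlen := hasDerivAt_length hP hη hC hvar hcan hW hG hW₂ hg hhs hh hJ hγ hε hab habJ hΓ
    refine hlen.congr_deriv ?_
    rw [intervalIntegral.integral_congr (g := fun _ => (0 : ℝ)) fun t ht => ?_]
    · simp
    · rw [uIcc_of_le hab.le] at ht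
      simp only
      rw [hGW _ (hγ.mem t (habJ ht)), sub_self, mul_zero, zero_mul]

end Geodesics

end ContactPath

theorem mainTheorem1 (P : Set (Vec 5)) (M : Set (Vec 3)) (ρ : Vec 5 → Vec 3)
    (L : Vec 5 → Submodule ℝ (Vec 5)) (hP : IsContactPathGeometry P M ρ L)
    (η : Coframe) (hη : η.IsAdapted P ρ L)
    (C : ConnectionData) (hC : η.StructureEquations C P)
    (hvar : C.IsVariational P) (hdef : C.IsDefinite P) (hcan : C.IsCanonical P)
    (W₀ W₁ W₂ : Vec 5 → ℝ) (hW : η.IsExpansionW C P W₀ W₁ W₂)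
    (H G₀ G₁ G₂ G₃ : Vec 5 → ℝ) (hG : η.IsExpansionG C P H G₀ G₁ G₂ G₃)
    (hW₂ : ∀ p ∈ P, W₂ p = 0) :
    (∃ g : SubRiemannianMetric M, g.IsDefinedBy η P ρ) ∧
    ∀ g : SubRiemannianMetric M, g.IsDefinedBy η P ρ →
      (PathsAreGeodesics P ρ L g ↔ ∀ p ∈ P, G₁ p = 2 * W₀ p) :=
  ⟨exists_metric hP hη hC hvar hcan hW hW₂, fun _ hg =>
    pathsAreGeodesics_iff hP hη hC hvar hcan hW hG hW₂ hg⟩
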